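/- Let $\kappa$ be a measurable cardinal, i.e. an uncountable cardinal carrying a $\kappa$-complete non-principal ultrafilter, and let $\alpha$ be an ordinal with $\omega\le\alpha<\kappa^{++}$. Let $\vec U=\langle U_\beta\mid\beta<\alpha\rangle$ be a sequence of non-principal $\kappa$-complete ultrafilters over $\kappa$. Say that $(j,M,\vec\eta)$ *weakly glues* $\vec U$ if $j\colon V\to M$ is an elementary embedding, definable with parameters, into a transitive class $M$ with $\mathrm{crit}(j)=\kappa$ and $M^\kappa\subseteq M$, and $\vec\eta=\langle\eta_\beta\mid\beta<\alpha\rangle$ is a sequence of ordinals such that $$U_\beta=\{X\subseteq\kappa\mid \eta_\beta\in j(X)\}\qquad\text{for all }\beta<\alpha.$$ Say that it *glues* $\vec U$ if moreover $\vec\eta$ is strictly increasing. The cardinal $\kappa$ has - the *weak $\alpha$-gluing property* if every such $\vec U$ is weakly glued by some $(j,M,\vec\eta)$; - the *$\alpha$-gluing property* if every such $\vec U$ is glued by some $(j,M,\vec\eta)$; - the *$\alpha$-gluing property via ultrafilters* if every such $\vec U$ is glued by some $(j,M,\vec\eta)$ where $j\colon V\to M\cong\mathrm{Ult}(V,W)$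 is the ultrapower embedding by a $\kappa$-complete ultrafilter $W$ on $\kappa^{<\kappa}$; - the *super $\alpha$-gluing property* if every such $\vec U$ is glued by some $(j,M,\vec\eta)$ with $\vec\eta\in M$. **Theorem.** Each of the following properties implies the next one in the list: 1. $\kappa$ has the super $\alpha$-gluing property. 2. $\kappa$ has the $\alpha$-gluing property via ultrafilters. 3. $\kappa$ has the $\alpha$-gluing property. 4. $\kappa$ has the weak $\alpha$-gluing property. Moreover, if $\alpha<\kappa^+$, then (1), (2) and (3) are equivalent. -/

import Mathlib

open FirstOrder Cardinal

universe u

/-! The universe of sets `V` is `ZFSet.{u}`. Classes are sets of elements of `ZFSet.{u}`, and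
cardinals and ordinals are those of the same universe. -/

namespace Gluing

/-- The relation symbols of the language of set theory: one binary symbol. -/
inductive MemRel : ℕ → Type
  | mem : MemRel 2

/-- The first-order language of set theory `{∈}`. -/
abbrev memLang : Language := ⟨fun _ => Empty, MemRel⟩

/-- The structure `(V, ∈)`. -/
instance instStructureV : memLang.Structure ZFSet.{u} where
  funMap f := nomatch f
  RelMap := fun
    | MemRel.mem, v => v 0 ∈ v 1

/-- The structure `(M, ∈)` for a class `M`. -/
instance instStructureClass (M : Set ZFSet.{u}) : memLang.Structure M where
  funMap f := nomatch f
  RelMap := fun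
    | MemRel.mem, v => (v 0 : ZFSet.{u}) ∈ (v 1 : ZFSet.{u})

/-- `U` is `κ`-complete: closed under intersections of fewer than `κ` members. -/
def IsComplete {X : Type u} (κ : Cardinal.{u}) (U : Ultrafilter X) : Prop :=
  CardinalInterFilter (U : Filter X) κ

/-- `U` is not principal. -/
def IsNonprincipal {X : Type u} (U : Ultrafilter X) : Prop :=
  ∀ a : X, {a} ∉ U

/-- `κ` is a measurable cardinal: it is uncountable and carries a `κ`-complete
non-principal ultrafilter. -/
def IsMeasurableCardinal (κ : Cardinal.{u}) : Prop :=
  ℵ₀ < κ ∧ ∃ U : Ultrafilter κ.ord.ToType, IsComplete κ U ∧ IsNonprincipal U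

/-- The set `κ^{<κ}` of all sequences of length less than `κ` of ordinals below `κ`. -/
abbrev SeqLT (κ : Cardinal.{u}) : Type u :=
  Σ γ : κ.ord.ToType, (Set.Iio γ → κ.ord.ToType)

/-- A subset `X` of `κ`, as an element of `V`. -/
noncomputable def codeSubset (κ : Cardinal.{u}) (X : Set κ.ord.ToType) : ZFSet.{u} :=
  ZFSet.range fun ξ : X => (ξ.1.toOrd : Ordinal.{u}).toZFSet

/-- The function `ξ ↦ f ξ` with domain a (von Neumann) ordinal `δ`, as an element of `V`. -/
noncomputable def codeSeq {δ : Ordinal.{u}} (f : Set.Iio δ → ZFSet.{u}) : ZFSet.{u} :=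
  ZFSet.range fun ξ : Set.Iio δ => ZFSet.pair (ξ : Ordinal.{u}).toZFSet (f ξ)

/-- `j : V → M` is a definable (with parameters) elementary embedding into a transitive class
`M`, with critical point `κ` and `M^κ ⊆ M`. -/
structure IsGoodEmbedding (κ : Cardinal.{u}) (M : Set ZFSet.{u})
    (j : ZFSet.{u} ↪ₑ[memLang] M) : Prop where
  transitive : ∀ x ∈ M, ∀ y ∈ x, y ∈ M
  definable : (Set.univ : Set ZFSet.{u}).Definable₂ memLang
    {p : ZFSet.{u} × ZFSet.{u} | p.2 = (j p.1 : ZFSet.{u})}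
  crit : IsLeast {ξ : Ordinal.{u} | (j ξ.toZFSet : ZFSet.{u}) ≠ ξ.toZFSet} κ.ord
  closed : ∀ f : Set.Iio κ.ord → ZFSet.{u}, (∀ ξ, f ξ ∈ M) → codeSeq f ∈ M

/-- `j` and the seeds `η` represent the ultrafilters `U`: for each `β < α`,
`U β = {X ⊆ κ | η β ∈ j X}`. -/
def Represents {κ : Cardinal.{u}} {α : Ordinal.{u}}
    (U : Set.Iio α → Ultrafilter κ.ord.ToType) {M : Set ZFSet.{u}}
    (j : ZFSet.{u} ↪ₑ[memLang] M) (η : Set.Iio α → Ordinal.{u}) : Prop :=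
  ∀ (β : Set.Iio α) (X : Set κ.ord.ToType),
    X ∈ U β ↔ (η β).toZFSet ∈ (j (codeSubset κ X) : ZFSet.{u})

/-- `M` is the transitive collapse of the ultrapower `Ult(V, W)` and `j : V → M` is the
ultrapower embedding: `π` is the collapsing isomorphism from the classes of functions `S → V`
modulo `W`, and `j x` is the collapse of the class of the constant function with value `x`. -/
def IsUltrapowerEmbedding {S : Type u} (W : Ultrafilter S) {M : Set ZFSet.{u}}
    (j : ZFSet.{u} ↪ₑ[memLang] M) : Prop :=
  (∀ x ∈ M, ∀ y ∈ x, y ∈ M) ∧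
  ∃ π : Filter.Germ (W : Filter S) ZFSet.{u} ≃ M,
    (∀ f g : S → ZFSet.{u},
      (π (f : Filter.Germ (W : Filter S) ZFSet.{u}) : ZFSet.{u}) ∈
          (π (g : Filter.Germ (W : Filter S) ZFSet.{u}) : ZFSet.{u}) ↔
        ∀ᶠ s in (W : Filter S), f s ∈ g s) ∧
    ∀ x : ZFSet.{u}, j x = π ((fun _ : S => x : S → ZFSet.{u}) : Filter.Germ (W : Filter S) ZFSet.{u})

/-- `κ` has the `α`-Gluing Property. -/
def HasGP (κ : Cardinal.{u}) (α : Ordinal.{u}) : Prop :=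
  ∀ U : Set.Iio α → Ultrafilter κ.ord.ToType,
    (∀ β, IsComplete κ (U β) ∧ IsNonprincipal (U β)) →
    ∃ (M : Set ZFSet.{u}) (j : ZFSet.{u} ↪ₑ[memLang] M) (η : Set.Iio α → Ordinal.{u}),
      IsGoodEmbedding κ M j ∧ StrictMono η ∧ Represents U j η

/-- `κ` has the super `α`-Gluing Property: the sequence of seeds can be taken in `M`. -/
def HasSuperGP (κ : Cardinal.{u}) (α : Ordinal.{u}) : Prop :=
  ∀ U : Set.Iio α → Ultrafilter κ.ord.ToType,
    (∀ β, IsComplete κ (U β) ∧ IsNonprincipal (U β)) →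
    ∃ (M : Set ZFSet.{u}) (j : ZFSet.{u} ↪ₑ[memLang] M) (η : Set.Iio α → Ordinal.{u}),
      IsGoodEmbedding κ M j ∧ StrictMono η ∧ Represents U j η ∧
      codeSeq (fun β => (η β).toZFSet) ∈ M

/-- `κ` has the `α`-Gluing Property via ultrafilters: the embedding can be taken to be the
ultrapower embedding by a `κ`-complete ultrafilter on `κ^{<κ}`. -/
def HasGPViaUltrafilters (κ : Cardinal.{u}) (α : Ordinal.{u}) : Prop :=
  ∀ U : Set.Iio α → Ultrafilter κ.ord.ToType,
    (∀ β, IsComplete κ (U β) ∧ IsNonprincipal (U β)) →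
    ∃ (M : Set ZFSet.{u}) (j : ZFSet.{u} ↪ₑ[memLang] M) (η : Set.Iio α → Ordinal.{u}),
      IsGoodEmbedding κ M j ∧ StrictMono η ∧ Represents U j η ∧
      ∃ W : Ultrafilter (SeqLT κ), IsComplete κ W ∧ IsUltrapowerEmbedding W j

/-- `κ` has the weak `α`-Gluing Property: the seeds need not be increasing. -/
def HasWeakGP (κ : Cardinal.{u}) (α : Ordinal.{u}) : Prop :=
  ∀ U : Set.Iio α → Ultrafilter κ.ord.ToType,
    (∀ β, IsComplete κ (U β) ∧ IsNonprincipal (U β)) →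
    ∃ (M : Set ZFSet.{u}) (j : ZFSet.{u} ↪ₑ[memLang] M) (η : Set.Iio α → Ordinal.{u}),
      IsGoodEmbedding κ M j ∧ Represents U j η

end Gluing

/-! The substance is that super gluing yields gluing via ultrafilters. When the seeds form a
sequence in `M`, their set `a` is a point of `j(P(κ))` and generates a `κ`-complete ultrafilter `E`
on `P(κ)`. Each seed must then be recovered from `a` by a function lying in `V`, although `α` may be
far larger than `κ`.

To this end the ultrafilters are tagged before gluing. Since `|α| ≤ 2^κ`, each block of `ω`
consecutive indices gets its own subset of `κ`, and `U β` is pushed forward along an increasing map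
whose range `P` is almost disjoint from the ranges of the other blocks (`exists_lex_code`; it needs
`κ` to be a strong limit). The seeds in `j(P)` are then exactly those of one block, so the seed of
`β` is the `n`-th element of `a ∩ j(P)`, where `n` is the position of `β` in its block
(`exists_ultrafilter_of_seeds`). Being the `n`-th element depends on a bounded part of the set only,
so `E` can be traded for an ultrafilter on `κ^{<κ}` (`exists_ultrafilter_seqLT`). Removing the tags
gives functions that project this ultrafilter to the `U β` and increase with `β`, and its ultrapower
glues (`exists_glue_of_ultrafilter`).

The ultrapower is built by hand: collapse, Łoś, definability, critical point, closure under
`κ`-sequences. For `α < κ⁺` that closure, in any `M`, already puts the seeds into `M`, so gluing is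
super gluing. The other implications drop a clause. -/

namespace Gluing

open FirstOrder.Language Filter

/-! ### Formulas absolute for transitive classes, and transfer along `j` -/

section Formulas

/-- The class `M` is transitive. -/
def TransClass (M : Set ZFSet.{u}) : Prop := ∀ x ∈ M, ∀ y ∈ x, y ∈ M

/-- `P` is expressed by a formula which is absolute between `V` and all transitive classes. -/
class Absolute {ι : Type*} (P : (ι → ZFSet.{u}) → Prop) : Prop where
  exists_formula : ∃ φ : memLang.Formula ι, (∀ v : ι → ZFSet.{u}, φ.Realize v ↔ P v) ∧
    ∀ M : Set ZFSet.{u}, TransClass M → ∀ v : ι → M, φ.Realize v ↔ P fun i => v i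

/-- `P` is expressed by a formula in `V`. -/
class Expressible {ι : Type*} (P : (ι → ZFSet.{u}) → Prop) : Prop where
  exists_formula : ∃ φ : memLang.Formula ι, ∀ v : ι → ZFSet.{u}, φ.Realize v ↔ P v

variable {ι : Type*}

theorem realize_mem_univ (i j : ι) (v : ι → ZFSet.{u}) :
    (Relations.formula₂ (L := memLang) MemRel.mem (Term.var i) (Term.var j)).Realize v ↔
      v i ∈ v j := by
  rw [Formula.realize_rel₂]
  rfl

theorem realize_mem_class (i j : ι) (M : Set ZFSet.{u}) (v : ι → M) :
    (Relations.formula₂ (L := memLang) MemRel.mem (Term.var i) (Term.var j)).Realize v ↔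
      (v i : ZFSet.{u}) ∈ (v j : ZFSet.{u}) := by
  rw [Formula.realize_rel₂]
  rfl

instance Absolute.mem (i j : ι) : Absolute fun v : ι → ZFSet.{u} => v i ∈ v j :=
  ⟨_, realize_mem_univ i j, fun M _ => realize_mem_class i j M⟩

instance Absolute.eq (i j : ι) : Absolute fun v : ι → ZFSet.{u} => v i = v j :=
  ⟨Term.equal (Term.var i) (Term.var j), fun v => by simp [Formula.realize_equal],
    fun M _ v => by simp [Formula.realize_equal, Subtype.ext_iff]⟩

variable {P Q : (ι → ZFSet.{u}) → Prop}

instance Absolute.not [hP : Absolute P] : Absolute fun v => ¬ P v := by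
  obtain ⟨φ, h1, h2⟩ := hP
  exact ⟨∼φ, fun v => by rw [Formula.realize_not, h1], fun M hM v => by
    rw [Formula.realize_not, h2 M hM]⟩

instance Absolute.imp [hP : Absolute P] [hQ : Absolute Q] : Absolute fun v => P v → Q v := by
  obtain ⟨φ, h1, h2⟩ := hP
  obtain ⟨ψ, h3, h4⟩ := hQ
  exact ⟨φ.imp ψ, fun v => by rw [Formula.realize_imp, h1, h3], fun M hM v => by
    rw [Formula.realize_imp, h2 M hM, h4 M hM]⟩

theorem Absolute.congr (hP : Absolute P) (h : ∀ v, P v ↔ Q v) : Absolute Q := by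
  rwa [show Q = P from funext fun v => propext (h v).symm]

instance Absolute.and [Absolute P] [Absolute Q] : Absolute fun v => P v ∧ Q v :=
  Absolute.congr (P := fun v => ¬ (P v → ¬ Q v)) inferInstance fun v => by tauto

instance Absolute.or [Absolute P] [Absolute Q] : Absolute fun v => P v ∨ Q v :=
  Absolute.congr (P := fun v => ¬ P v → Q v) inferInstance fun v => by tauto

instance Absolute.iff [Absolute P] [Absolute Q] : Absolute fun v => P v ↔ Q v :=
  Absolute.congr (P := fun v => (P v → Q v) ∧ (Q v → P v)) inferInstance fun v => by tauto

/-- This is where transitivity enters: a bounded quantifier ranges over the same sets in `M` and in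
`V`. Together with the connectives it lets instance search recognise bounded formulas; the bound
variable is the index `.inr ()`. -/
instance Absolute.ball (i : ι) {R : (ι → ZFSet.{u}) → ZFSet.{u} → Prop}
    [h : Absolute fun w : ι ⊕ Unit → ZFSet.{u} => R (fun i => w (.inl i)) (w (.inr ()))] :
    Absolute fun v => ∀ x ∈ v i, R v x := by
  obtain ⟨φ, h1, h2⟩ := h
  refine ⟨((Relations.formula₂ (L := memLang) MemRel.mem (Term.var (.inr ()))
    (Term.var (.inl i))).imp φ).iAlls Unit, fun v => ?_, fun M hM v => ?_⟩
  · rw [Formula.realize_iAlls]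
    simp only [Formula.realize_imp, realize_mem_univ, h1, Sum.elim_inl, Sum.elim_inr]
    exact ⟨fun h x hx => h (fun _ => x) hx, fun h x hx => h (x ()) hx⟩
  · rw [Formula.realize_iAlls]
    simp only [Formula.realize_imp, realize_mem_class, h2 M hM, Sum.elim_inl, Sum.elim_inr]
    exact ⟨fun h x hx => h (fun _ => ⟨x, hM _ (v i).2 x hx⟩) hx, fun h x hx => h (x ()) hx⟩

instance Absolute.bex (i : ι) {R : (ι → ZFSet.{u}) → ZFSet.{u} → Prop}
    [Absolute fun w : ι ⊕ Unit → ZFSet.{u} => R (fun i => w (.inl i)) (w (.inr ()))] :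
    Absolute fun v => ∃ x ∈ v i, R v x :=
  Absolute.congr (P := fun v => ¬ ∀ x ∈ v i, ¬ R v x) inferInstance fun v => by
    push Not; rfl

instance Absolute.subset (i j : ι) : Absolute fun v : ι → ZFSet.{u} => v i ⊆ v j :=
  Absolute.congr (P := fun v => ∀ x ∈ v i, x ∈ v j) inferInstance fun v => by
    rw [ZFSet.subset_def]

/-- Kuratowski pairs, with bounded quantifiers only. -/
theorem eq_pair_iff {z x y : ZFSet.{u}} : z = ZFSet.pair x y ↔
    (∃ a ∈ z, (∀ w ∈ a, w = x) ∧ x ∈ a) ∧ (∃ b ∈ z, (∀ w ∈ b, w = x ∨ w = y) ∧ x ∈ b ∧ y ∈ b) ∧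
      ∀ c ∈ z, ((∀ w ∈ c, w = x) ∧ x ∈ c) ∨ ((∀ w ∈ c, w = x ∨ w = y) ∧ x ∈ c ∧ y ∈ c) := by
  have h1 : ∀ a : ZFSet.{u}, ((∀ w ∈ a, w = x) ∧ x ∈ a) ↔ a = {x} := fun a => by
    constructor
    · rintro ⟨h, hx⟩
      ext w
      rw [ZFSet.mem_singleton]
      exact ⟨h w, fun e => e ▸ hx⟩
    · rintro rfl
      simp
  have h2 : ∀ b : ZFSet.{u}, ((∀ w ∈ b, w = x ∨ w = y) ∧ x ∈ b ∧ y ∈ b) ↔ b = {x, y} := fun b => by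
    constructor
    · rintro ⟨h, hx, hy⟩
      ext w
      rw [ZFSet.mem_pair]
      exact ⟨h w, by rintro (e | e) <;> simpa [e]⟩
    · rintro rfl
      simp
  simp only [h1, h2, exists_eq_right]
  constructor
  · rintro rfl
    simp [ZFSet.pair]
  · rintro ⟨ha, hb, hc⟩
    ext w
    rw [ZFSet.pair, ZFSet.mem_pair]
    exact ⟨hc w, by rintro (e | e) <;> simpa [e]⟩

instance Absolute.eq_pair (i j k : ι) :
    Absolute fun v : ι → ZFSet.{u} => v i = ZFSet.pair (v j) (v k) :=
  Absolute.congr inferInstance fun _ => eq_pair_iff.symm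

instance Absolute.pair_mem (i j k : ι) :
    Absolute fun v : ι → ZFSet.{u} => ZFSet.pair (v j) (v k) ∈ v i :=
  Absolute.congr (P := fun v => ∃ z ∈ v i, z = ZFSet.pair (v j) (v k)) inferInstance fun v => by
    simp

instance Absolute.isOrdinal (i : ι) : Absolute fun v : ι → ZFSet.{u} => (v i).IsOrdinal :=
  Absolute.congr (P := fun v => (∀ y ∈ v i, y ⊆ v i) ∧ ∀ y ∈ v i, ∀ z ∈ y, z ⊆ y)
    inferInstance fun v => by
    rw [ZFSet.isOrdinal_iff_forall_mem_isTransitive]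
    rfl

instance Expressible.of_absolute [h : Absolute P] : Expressible P := by
  obtain ⟨φ, h, _⟩ := h
  exact ⟨φ, h⟩

instance Expressible.not [hP : Expressible P] : Expressible fun v => ¬ P v := by
  obtain ⟨φ, h1⟩ := hP
  exact ⟨∼φ, fun v => by rw [Formula.realize_not, h1]⟩

instance Expressible.imp [hP : Expressible P] [hQ : Expressible Q] :
    Expressible fun v => P v → Q v := by
  obtain ⟨φ, h1⟩ := hP
  obtain ⟨ψ, h3⟩ := hQ
  exact ⟨φ.imp ψ, fun v => by rw [Formula.realize_imp, h1, h3]⟩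

theorem Expressible.congr (hP : Expressible P) (h : ∀ v, P v ↔ Q v) : Expressible Q := by
  rwa [show Q = P from funext fun v => propext (h v).symm]

instance Expressible.and [Expressible P] [Expressible Q] : Expressible fun v => P v ∧ Q v :=
  Expressible.congr (P := fun v => ¬ (P v → ¬ Q v)) inferInstance fun v => by tauto

instance Expressible.iff [Expressible P] [Expressible Q] : Expressible fun v => P v ↔ Q v :=
  Expressible.congr (P := fun v => (P v → Q v) ∧ (Q v → P v)) inferInstance fun v => by tauto

/-- Unbounded quantifiers lose absoluteness, but are harmless for definability in `V`. -/
instance Expressible.all {R : (ι → ZFSet.{u}) → ZFSet.{u} → Prop}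
    [h : Expressible fun w : ι ⊕ Unit → ZFSet.{u} => R (fun i => w (.inl i)) (w (.inr ()))] :
    Expressible fun v => ∀ x, R v x := by
  obtain ⟨φ, h1⟩ := h
  refine ⟨φ.iAlls Unit, fun v => ?_⟩
  rw [Formula.realize_iAlls]
  simp only [h1, Sum.elim_inl, Sum.elim_inr]
  exact ⟨fun h x => h fun _ => x, fun h x => h (x ())⟩

instance Expressible.ex {R : (ι → ZFSet.{u}) → ZFSet.{u} → Prop}
    [Expressible fun w : ι ⊕ Unit → ZFSet.{u} => R (fun i => w (.inl i)) (w (.inr ()))] :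
    Expressible fun v => ∃ x, R v x :=
  Expressible.congr (P := fun v => ¬ ∀ x, ¬ R v x) inferInstance fun v => by
    push Not; rfl

theorem definable₂_of_expressible {s : Set (ZFSet.{u} × ZFSet.{u})}
    {P : (((Set.univ : Set ZFSet.{u}) ⊕ Fin 2) → ZFSet.{u}) → Prop} [h : Expressible P]
    (hs : ∀ x y, (x, y) ∈ s ↔ P (Sum.elim (fun c => (c : ZFSet.{u})) ![x, y])) :
    (Set.univ : Set ZFSet.{u}).Definable₂ memLang s := by
  obtain ⟨φ, h⟩ := h
  refine Set.definable_iff_exists_formula_sum.2 ⟨φ, ?_⟩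
  ext v
  have hv : v = ![v 0, v 1] := by
    funext i
    fin_cases i <;> rfl
  simp only [Set.mem_ofPred_eq]
  rw [hs, ← h, ← hv]

variable {M : Set ZFSet.{u}} (j : ZFSet.{u} ↪ₑ[memLang] M)

theorem Absolute.transfer [h : Absolute P] (hM : TransClass M) (v : ι → ZFSet.{u}) :
    P v ↔ P fun i => (j (v i) : ZFSet.{u}) := by
  obtain ⟨φ, h1, h2⟩ := h
  rw [← h1, ← j.map_formula, h2 M hM]
  rfl

/-- The quantifiers range over `V` on one side and over `M` on the other. This shows that `M` is
closed under simple operations (pairs, ranges) and that `j(P(κ))` contains every subset of `j(κ)`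
lying in `M`. -/
theorem Absolute.transfer_forall_exists {β γ : Type} [Finite β] [Finite γ]
    {P : (((ι ⊕ β) ⊕ γ) → ZFSet.{u}) → Prop} [h : Absolute P] (hM : TransClass M)
    (v : ι → ZFSet.{u}) :
    (∀ x : β → ZFSet.{u}, ∃ y : γ → ZFSet.{u}, P (Sum.elim (Sum.elim v x) y)) ↔
      ∀ x : β → M, ∃ y : γ → M,
        P (Sum.elim (Sum.elim (fun i => (j (v i) : ZFSet.{u})) fun i => (x i : ZFSet.{u}))
          fun i => (y i : ZFSet.{u})) := by
  obtain ⟨φ, h1, h2⟩ := h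
  have := j.map_formula ((φ.iExs γ).iAlls β) v
  simp only [Formula.realize_iAlls, Formula.realize_iExs, h1, h2 M hM] at this
  rw [← this]
  refine forall_congr' fun x => exists_congr fun y => iff_of_eq (congrArg P ?_)
  funext i
  rcases i with (i | i) | i <;> rfl

end Formulas

/-! ### The collapsed ultrapower and Łoś's theorem -/

section Ultrapower

variable {S : Type u} (W : Ultrafilter S)

/-- The membership relation of the ultrapower of `V` by `W`. -/
def UltraMem (g f : Germ (W : Filter S) ZFSet.{u}) : Prop := Germ.LiftRel (· ∈ ·) g f

/-- By countable completeness a descending sequence of germs descends at all steps simultaneously at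
a single `s`, against foundation in `V`. -/
theorem ultraMem_wellFounded [CountableInterFilter (W : Filter S)] :
    WellFounded (UltraMem W) := by
  rw [wellFounded_iff_isEmpty_descending_chain]
  refine ⟨fun ⟨a, ha⟩ => ?_⟩
  choose f hf using fun n : ℕ => Quotient.exists_rep (a n)
  have h : ∀ᶠ s in (W : Filter S), ∀ n : ℕ, f (n + 1) s ∈ f n s := by
    refine eventually_countable_forall.2 fun n => ?_
    have h1 := ha n
    rw [← hf, ← hf] at h1
    exact h1
  obtain ⟨s, hs⟩ := h.exists
  exact (wellFounded_iff_isEmpty_descending_chain.1 ZFSet.mem_wf).false ⟨fun n => f n s, hs⟩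

instance small_ultraMem (f : Germ (W : Filter S) ZFSet.{u}) :
    Small.{u} {g // UltraMem W g f} := by
  obtain ⟨f, rfl⟩ := Quotient.exists_rep f
  -- Adding `f s` itself to the codomain leaves a default value where `g s ∉ f s`, even if `f s` is
  -- empty.
  let c : (∀ s, ((insert (f s) (f s) : ZFSet.{u}) : Type _)) → Germ (W : Filter S) ZFSet.{u} :=
    fun t => ((fun s => (t s : ZFSet.{u}) : S → ZFSet.{u}) : Germ (W : Filter S) ZFSet.{u})
  refine small_subset (t := {g | UltraMem W g _}) (s := Set.range c) fun g hg => ?_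
  obtain ⟨g, rfl⟩ := Quotient.exists_rep g
  classical
  refine ⟨fun s => if h : g s ∈ f s then ⟨g s, ZFSet.mem_insert_of_mem _ h⟩ else
    ⟨f s, ZFSet.mem_insert _ _⟩, Germ.coe_eq.2 ?_⟩
  have hg' : ∀ᶠ s in (W : Filter S), g s ∈ f s := hg
  filter_upwards [hg'] with s hs
  simp [hs]

theorem ultraMem_coe {f g : S → ZFSet.{u}} :
    UltraMem W (f : Germ (W : Filter S) ZFSet.{u}) g ↔ ∀ᶠ s in (W : Filter S), f s ∈ g s :=
  Iff.rfl

variable [hW : CountableInterFilter (W : Filter S)]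

/-- The transitive collapse of the ultrapower of `V` by `W`. -/
noncomputable def ultraCollapse : Germ (W : Filter S) ZFSet.{u} → ZFSet.{u} :=
  (ultraMem_wellFounded W).fix fun f c =>
    ZFSet.range fun g : {g // UltraMem W g f} => c g.1 g.2

variable {W}

theorem mem_ultraCollapse {f : Germ (W : Filter S) ZFSet.{u}} {y : ZFSet.{u}} :
    y ∈ ultraCollapse W f ↔ ∃ g, UltraMem W g f ∧ ultraCollapse W g = y := by
  rw [ultraCollapse, WellFounded.fix_eq]
  simp

/-- Extensionality of the ultrapower: if `f` and `g` differ almost everywhere, the ultrafilter picks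
one of `f s ⊈ g s`, `g s ⊈ f s` as the typical case, and choosing witnesses gives a germ in one but
not in the other. -/
theorem ultraCollapse_injective : Function.Injective (ultraCollapse W) := by
  intro f
  induction f using (ultraMem_wellFounded W).induction with
  | _ f ih =>
  intro g hfg
  by_contra hne
  obtain ⟨f, rfl⟩ := Quotient.exists_rep f
  obtain ⟨g, rfl⟩ := Quotient.exists_rep g
  have key : ∀ a b : S → ZFSet.{u}, (∀ᶠ s in (W : Filter S), ∃ x ∈ a s, x ∉ b s) →
      ∃ h : S → ZFSet.{u}, UltraMem W (h : Germ (W : Filter S) ZFSet.{u}) a ∧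
        ¬ UltraMem W (h : Germ (W : Filter S) ZFSet.{u}) b := by
    intro a b hab
    choose! h hh using fun (s : S) (hs : ∃ x ∈ a s, x ∉ b s) => hs
    refine ⟨h, hab.mono fun s hs => (hh s hs).1, ?_⟩
    rw [ultraMem_coe, ← Ultrafilter.eventually_not]
    exact hab.mono fun s hs => (hh s hs).2
  have h1 : ∀ᶠ s in (W : Filter S), (∃ x ∈ f s, x ∉ g s) ∨ ∃ x ∈ g s, x ∉ f s := by
    have : ∀ᶠ s in (W : Filter S), ¬ f s = g s :=
      Ultrafilter.eventually_not.2 fun h => hne (Germ.coe_eq.2 h)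
    filter_upwards [this] with s hs
    by_contra! hcon
    exact hs (ZFSet.ext fun x => ⟨hcon.1 x, hcon.2 x⟩)
  rcases Ultrafilter.eventually_or.1 h1 with h1 | h1
  · obtain ⟨h, ha, hb⟩ := key f g h1
    have h2 : ultraCollapse W h ∈ ultraCollapse W ⟦f⟧ := mem_ultraCollapse.2 ⟨_, ha, rfl⟩
    rw [hfg] at h2
    obtain ⟨h', hh', e⟩ := mem_ultraCollapse.1 h2
    rw [← ih _ ha e.symm] at hh'
    exact hb hh'
  · obtain ⟨h, ha, hb⟩ := key g f h1
    have h2 : ultraCollapse W h ∈ ultraCollapse W ⟦g⟧ := mem_ultraCollapse.2 ⟨_, ha, rfl⟩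
    rw [← hfg] at h2
    obtain ⟨h', hh', e⟩ := mem_ultraCollapse.1 h2
    rw [ih _ hh' e] at hh'
    exact hb hh'

theorem ultraCollapse_mem_iff {f g : Germ (W : Filter S) ZFSet.{u}} :
    ultraCollapse W f ∈ ultraCollapse W g ↔ UltraMem W f g := by
  rw [mem_ultraCollapse]
  refine ⟨?_, fun h => ⟨_, h, rfl⟩⟩
  rintro ⟨h, hh, e⟩
  rwa [← ultraCollapse_injective e]

variable (W) in
/-- The class onto which the ultrapower by `W` collapses. -/
def ultraClass : Set ZFSet.{u} := Set.range (ultraCollapse W)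

theorem ultraClass_transitive : TransClass (ultraClass W) := by
  rintro _ ⟨f, rfl⟩ y hy
  obtain ⟨g, _, rfl⟩ := mem_ultraCollapse.1 hy
  exact ⟨g, rfl⟩

variable (W) in
/-- The collapse, as a bijection. -/
noncomputable def ultraEquiv : Germ (W : Filter S) ZFSet.{u} ≃ ultraClass W :=
  Equiv.ofInjective _ ultraCollapse_injective

variable (W) in
/-- The collapse is an isomorphism of structures. -/
noncomputable def ultraIso :
    (W : Filter S).Product (fun _ : S => ZFSet.{u}) ≃[memLang] ultraClass W where
  toEquiv := ultraEquiv W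
  map_fun' f := nomatch f
  map_rel' := by
    rintro _ ⟨⟩ x
    choose f hf using fun i => Quotient.exists_rep (x i)
    obtain rfl : (fun i => ⟦f i⟧) = x := funext hf
    rw [iff_comm]
    refine (relMap_quotient_mk' ((W : Filter S).productSetoid fun _ : S => ZFSet.{u})
      (L := memLang) MemRel.mem f).trans ?_
    exact (ultraCollapse_mem_iff (W := W) (f := (f 0 : Germ (W : Filter S) ZFSet.{u}))
      (g := (f 1 : Germ (W : Filter S) ZFSet.{u}))).symm

/-- **Łoś's theorem** for the collapsed ultrapower. -/
theorem realize_ultraClass {ι : Type*} (φ : memLang.Formula ι) (F : ι → S → ZFSet.{u}) :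
    φ.Realize (fun i => ultraEquiv W (F i : Germ (W : Filter S) ZFSet.{u})) ↔
      ∀ᶠ s in (W : Filter S), φ.Realize fun i => F i s := by
  rw [← Ultraproduct.realize_formula_cast]
  exact StrongHomClass.realize_formula (ultraIso W) φ

variable (W) in
/-- The ultrapower embedding. -/
noncomputable def ultraEmbedding : ZFSet.{u} ↪ₑ[memLang] ultraClass W where
  toFun x := ultraEquiv W ((fun _ => x : S → ZFSet.{u}) : Germ (W : Filter S) ZFSet.{u})
  map_formula' n φ x := by
    refine (realize_ultraClass φ fun i _ => x i).trans ?_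
    simp only [eventually_const]

theorem ultraEmbedding_apply (x : ZFSet.{u}) : (ultraEmbedding W x : ZFSet.{u}) =
    ultraCollapse W ((fun _ => x : S → ZFSet.{u}) : Germ (W : Filter S) ZFSet.{u}) := rfl

theorem Absolute.ultraCollapse_iff {ι : Type*} {P : (ι → ZFSet.{u}) → Prop} [h : Absolute P]
    (F : ι → S → ZFSet.{u}) :
    P (fun i => ultraCollapse W (F i : Germ (W : Filter S) ZFSet.{u})) ↔
      ∀ᶠ s in (W : Filter S), P fun i => F i s := by
  obtain ⟨φ, h1, h2⟩ := h
  simp only [← h1]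
  rw [← realize_ultraClass, h2 _ ultraClass_transitive, ← h1]
  simp only [h1]
  rfl

theorem isUltrapowerEmbedding_ultraEmbedding :
    IsUltrapowerEmbedding W (ultraEmbedding W) :=
  ⟨ultraClass_transitive, ultraEquiv W, fun _ _ => ultraCollapse_mem_iff, fun _ => rfl⟩

end Ultrapower

instance Absolute.isFunc {ι : Type*} (i j k : ι) :
    Absolute fun v : ι → ZFSet.{u} => ZFSet.IsFunc (v i) (v j) (v k) :=
  Absolute.congr (P := fun v => (∀ p ∈ v k, ∃ a ∈ v i, ∃ b ∈ v j, p = ZFSet.pair a b) ∧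
    ∀ a ∈ v i, ∃ b ∈ v j, ZFSet.pair a b ∈ v k ∧ ∀ c ∈ v j, ZFSet.pair a c ∈ v k → c = b)
    inferInstance fun v => by
    simp only [ZFSet.IsFunc, ZFSet.subset_def, ZFSet.mem_prod]
    refine and_congr_right fun h => forall₂_congr fun a _ => ?_
    have h' : ∀ {b}, ZFSet.pair a b ∈ v k → b ∈ v j := fun hb => by
      obtain ⟨_, _, b', hb', e⟩ := h _ hb
      rwa [(ZFSet.pair_inj.1 e).2]
    exact ⟨fun ⟨b, _, hb, hu⟩ => ⟨b, hb, fun c hc => hu c (h' hc) hc⟩,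
      fun ⟨b, hb, hu⟩ => ⟨b, h' hb, hb, fun c _ hc => hu c hc⟩⟩

/-! ### Definability of the ultrapower embedding -/

section Code

variable {S : Type u}

/-- An injection of a small type into `V`. -/
noncomputable def pointCode (s : S) : ZFSet.{u} :=
  (Ordinal.typein (WellOrderingRel (α := S)) s).toZFSet

theorem pointCode_injective : Function.Injective (pointCode (S := S)) :=
  Ordinal.toZFSet_injective.comp (Ordinal.typein_injective _)

/-- A set of points, as an element of `V`. -/
noncomputable def pointSetCode (X : Set S) : ZFSet.{u} := ZFSet.range fun s : X => pointCode s.1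

/-- A function from a small type to `V`, as an element of `V`. -/
noncomputable def funCode (f : S → ZFSet.{u}) : ZFSet.{u} :=
  ZFSet.range fun s => ZFSet.pair (pointCode s) (f s)

theorem mem_pointSetCode {X : Set S} {z : ZFSet.{u}} :
    z ∈ pointSetCode X ↔ ∃ s ∈ X, pointCode s = z := by
  simp [pointSetCode]

theorem pair_mem_funCode {f : S → ZFSet.{u}} {s : S} {a : ZFSet.{u}} :
    ZFSet.pair (pointCode s) a ∈ funCode f ↔ a = f s := by
  simp only [funCode, ZFSet.mem_range, ZFSet.pair_inj, pointCode_injective.eq_iff]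
  constructor
  · rintro ⟨_, rfl, rfl⟩
    rfl
  · rintro rfl
    exact ⟨s, rfl, rfl⟩

theorem isFunc_pointSetCode_iff {T φ : ZFSet.{u}} :
    ZFSet.IsFunc (pointSetCode (Set.univ : Set S)) T φ ↔
      ∃ f : S → ZFSet.{u}, (∀ s, f s ∈ T) ∧ φ = funCode f := by
  constructor
  · rintro ⟨h1, h2⟩
    choose f hf hu using fun s : S =>
      h2 (pointCode s) (mem_pointSetCode.2 ⟨s, Set.mem_univ _, rfl⟩)
    refine ⟨f, fun s => (ZFSet.pair_mem_prod.1 (h1 (hf s))).2, ?_⟩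
    ext z
    constructor
    · intro hz
      obtain ⟨a, ha, b, -, rfl⟩ := ZFSet.mem_prod.1 (h1 hz)
      obtain ⟨s, -, rfl⟩ := mem_pointSetCode.1 ha
      exact pair_mem_funCode.2 (hu s b hz)
    · intro hz
      obtain ⟨s, rfl⟩ := ZFSet.mem_range.1 hz
      exact hf s
  · rintro ⟨f, hf, rfl⟩
    refine ⟨fun z hz => ?_, fun z hz => ?_⟩
    · obtain ⟨s, rfl⟩ := ZFSet.mem_range.1 hz
      exact ZFSet.pair_mem_prod.2 ⟨mem_pointSetCode.2 ⟨s, Set.mem_univ _, rfl⟩, hf s⟩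
    · obtain ⟨s, -, rfl⟩ := mem_pointSetCode.1 hz
      exact ⟨f s, pair_mem_funCode.2 rfl, fun c hc => pair_mem_funCode.1 hc⟩

/-- An ultrafilter, as an element of `V`. -/
noncomputable def ultrafilterCode (W : Ultrafilter S) : ZFSet.{u} :=
  ZFSet.range fun X : {X : Set S // X ∈ W} => pointSetCode X.1

theorem exists_mem_ultrafilterCode_iff {W : Ultrafilter S} {T : ZFSet.{u}} {f g : S → ZFSet.{u}}
    (hf : ∀ s, f s ∈ T) (hg : ∀ s, g s ∈ T) :
    (∃ X ∈ ultrafilterCode W, ∀ s ∈ X, ∃ a ∈ T, ∃ b ∈ T, ZFSet.pair s a ∈ funCode g ∧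
      ZFSet.pair s b ∈ funCode f ∧ a ∈ b) ↔ ∀ᶠ s in (W : Filter S), g s ∈ f s := by
  constructor
  · rintro ⟨X, hX, h⟩
    obtain ⟨⟨X, hXW⟩, rfl⟩ := ZFSet.mem_range.1 hX
    refine mem_of_superset hXW fun s hs => ?_
    obtain ⟨a, -, b, -, ha, hb, hab⟩ := h _ (mem_pointSetCode.2 ⟨s, hs, rfl⟩)
    rwa [pair_mem_funCode.1 ha, pair_mem_funCode.1 hb] at hab
  · intro h
    refine ⟨_, ZFSet.mem_range.2 ⟨⟨_, h⟩, rfl⟩, fun z hz => ?_⟩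
    obtain ⟨s, hs, rfl⟩ := mem_pointSetCode.1 hz
    exact ⟨g s, hg s, f s, hf s, pair_mem_funCode.2 rfl, pair_mem_funCode.2 rfl, hs⟩

/-- Transitivity of `T` keeps the recursion for the collapse among functions into `T`, which form a
set; `f s` is the default value off the large set. -/
theorem exists_rep_of_ultraMem {W : Ultrafilter S} {T : ZFSet.{u}} (hT : ∀ y ∈ T, y ⊆ T)
    {f : S → ZFSet.{u}} (hf : ∀ s, f s ∈ T) {g : Germ (W : Filter S) ZFSet.{u}}
    (hg : UltraMem W g f) : ∃ g' : S → ZFSet.{u}, (∀ s, g' s ∈ T) ∧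
      (g' : Germ (W : Filter S) ZFSet.{u}) = g ∧ ∀ᶠ s in (W : Filter S), g' s ∈ f s := by
  obtain ⟨g, rfl⟩ := Quotient.exists_rep g
  classical
  have hgf : ∀ᶠ s in (W : Filter S), g s ∈ f s := hg
  refine ⟨fun s => if g s ∈ f s then g s else f s, fun s => ?_,
    Germ.coe_eq.2 (hgf.mono fun s hs => if_pos hs), hgf.mono fun s hs => ?_⟩
  · by_cases hs : g s ∈ f s
    · simp only [if_pos hs]
      exact hT _ (hf s) hs
    · simp only [if_neg hs]
      exact hf s
  · simpa only [if_pos hs] using hs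

/-- `C` is a set of pairs `(f, c)`, where `f : S → T`, satisfying the recursive description of the
collapse of the ultrapower. -/
def IsCollapseOn (S' W' T C : ZFSet.{u}) : Prop :=
  (∀ y ∈ T, y ⊆ T) ∧ (∀ f, ZFSet.IsFunc S' T f → ∃ c, ZFSet.pair f c ∈ C) ∧
    ∀ f c, ZFSet.IsFunc S' T f → ZFSet.pair f c ∈ C → ∀ d, d ∈ c ↔
      ∃ g, ZFSet.IsFunc S' T g ∧ ZFSet.pair g d ∈ C ∧
        ∃ X ∈ W', ∀ s ∈ X, ∃ a ∈ T, ∃ b ∈ T, ZFSet.pair s a ∈ g ∧ ZFSet.pair s b ∈ f ∧ a ∈ b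

instance Expressible.isCollapseOn {ι : Type*} (i j k l : ι) :
    Expressible fun v : ι → ZFSet.{u} => IsCollapseOn (v i) (v j) (v k) (v l) := by
  unfold IsCollapseOn
  infer_instance

variable {W : Ultrafilter S} [CountableInterFilter (W : Filter S)]

theorem IsCollapseOn.eq_ultraCollapse {T C : ZFSet.{u}}
    (h : IsCollapseOn (pointSetCode (Set.univ : Set S)) (ultrafilterCode W) T C)
    {f : S → ZFSet.{u}} (hf : ∀ s, f s ∈ T) {c : ZFSet.{u}} (hc : ZFSet.pair (funCode f) c ∈ C) :
    c = ultraCollapse W f := by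
  obtain ⟨hT, h1, h2⟩ := h
  induction c using ZFSet.inductionOn generalizing f with
  | _ c ih =>
  have h3 := h2 _ c (isFunc_pointSetCode_iff.2 ⟨f, hf, rfl⟩) hc
  ext d
  constructor
  · intro hd
    obtain ⟨g, hg, hgd, hgf⟩ := (h3 d).1 hd
    obtain ⟨g, hgT, rfl⟩ := isFunc_pointSetCode_iff.1 hg
    rw [ih d hd hgT hgd]
    exact ultraCollapse_mem_iff.2 ((exists_mem_ultrafilterCode_iff hf hgT).1 hgf)
  · intro hd
    obtain ⟨g, hgf, rfl⟩ := mem_ultraCollapse.1 hd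
    obtain ⟨g', hgT, rfl, hgf'⟩ := exists_rep_of_ultraMem hT hf hgf
    have hfun := isFunc_pointSetCode_iff.2 ⟨g', hgT, rfl⟩
    obtain ⟨d, hd⟩ := h1 _ hfun
    have hdc : d ∈ c := (h3 d).2 ⟨_, hfun, hd, (exists_mem_ultrafilterCode_iff hf hgT).2 hgf'⟩
    exact ih d hdc hgT hd ▸ hdc

theorem exists_isCollapseOn (T : ZFSet.{u}) (hT : ∀ y ∈ T, y ⊆ T) :
    ∃ C, IsCollapseOn (pointSetCode (Set.univ : Set S)) (ultrafilterCode W) T C ∧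
      ∀ f : S → ZFSet.{u}, (∀ s, f s ∈ T) →
        ZFSet.pair (funCode f) (ultraCollapse W f) ∈ C := by
  let C : ZFSet.{u} := ZFSet.range fun f : S → (T : Type _) =>
    ZFSet.pair (funCode fun s => (f s : ZFSet.{u}))
      (ultraCollapse W ((fun s => (f s : ZFSet.{u}) : S → ZFSet.{u}) : Germ (W : Filter S) _))
  have hC : ∀ f : S → ZFSet.{u}, (∀ s, f s ∈ T) →
      ZFSet.pair (funCode f) (ultraCollapse W f) ∈ C := fun f hf =>
    ZFSet.mem_range.2 ⟨fun s => ⟨f s, hf s⟩, rfl⟩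
  have hC' : ∀ (f : S → ZFSet.{u}) c, ZFSet.pair (funCode f) c ∈ C → c = ultraCollapse W f := by
    intro f c hc
    obtain ⟨g, hg⟩ := ZFSet.mem_range.1 hc
    obtain ⟨h1, h2⟩ := ZFSet.pair_inj.1 hg
    have e : (fun s => (g s : ZFSet.{u})) = f := funext fun s =>
      pair_mem_funCode.1 (h1 ▸ pair_mem_funCode.2 rfl)
    rw [← h2, e]
  refine ⟨C, ⟨hT, fun φ hφ => ?_, fun φ c hφ hc d => ?_⟩, hC⟩
  · obtain ⟨f, hf, rfl⟩ := isFunc_pointSetCode_iff.1 hφ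
    exact ⟨_, hC f hf⟩
  · obtain ⟨f, hf, rfl⟩ := isFunc_pointSetCode_iff.1 hφ
    rw [hC' f c hc]
    constructor
    · intro hd
      obtain ⟨g, hgf, rfl⟩ := mem_ultraCollapse.1 hd
      obtain ⟨g', hgT, rfl, hgf'⟩ := exists_rep_of_ultraMem hT hf hgf
      exact ⟨_, isFunc_pointSetCode_iff.2 ⟨g', hgT, rfl⟩, hC g' hgT,
        (exists_mem_ultrafilterCode_iff hf hgT).2 hgf'⟩
    · rintro ⟨φ, hφ, hd, hX⟩
      obtain ⟨g, hg, rfl⟩ := isFunc_pointSetCode_iff.1 hφ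
      rw [hC' g d hd]
      exact ultraCollapse_mem_iff.2 ((exists_mem_ultrafilterCode_iff hf hg).1 hX)

/-- The collapse is a class recursion, so it is described by set approximations: `y = j x` iff some
`C`, obeying the recursion on functions into a transitive `T ∋ x`, sends the constant function `x`
to `y`. Approximations exist on every level `V_o` and all agree with the collapse. -/
theorem definable₂_ultraEmbedding : (Set.univ : Set ZFSet.{u}).Definable₂ memLang
    {p : ZFSet.{u} × ZFSet.{u} | p.2 = (ultraEmbedding W p.1 : ZFSet.{u})} := by
  refine definable₂_of_expressible (P := fun v => ∃ T C, IsCollapseOn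
    (v (.inl ⟨pointSetCode (Set.univ : Set S), trivial⟩)) (v (.inl ⟨ultrafilterCode W, trivial⟩))
      T C ∧ v (.inr 0) ∈ T ∧
    ∃ f, ZFSet.IsFunc (v (.inl ⟨pointSetCode (Set.univ : Set S), trivial⟩)) T f ∧
      (∀ s ∈ v (.inl ⟨pointSetCode (Set.univ : Set S), trivial⟩),
        ZFSet.pair s (v (.inr 0)) ∈ f) ∧ ZFSet.pair f (v (.inr 1)) ∈ C) fun x y => ?_
  simp only [Sum.elim_inl, Sum.elim_inr, Matrix.cons_val_zero, Matrix.cons_val_one,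
    Set.mem_ofPred_eq]
  constructor
  · rintro rfl
    obtain ⟨o, ho⟩ := ZFSet.exists_mem_vonNeumann x
    obtain ⟨C, hC, hC'⟩ := exists_isCollapseOn (W := W) _ (ZFSet.isTransitive_vonNeumann o)
    refine ⟨_, C, hC, ho, _, isFunc_pointSetCode_iff.2 ⟨fun _ => x, fun _ => ho, rfl⟩,
      fun s hs => ?_, hC' _ fun _ => ho⟩
    obtain ⟨s, -, rfl⟩ := mem_pointSetCode.1 hs
    exact pair_mem_funCode.2 rfl
  · rintro ⟨T, C, hC, hx, φ, hφ, hs, hy⟩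
    obtain ⟨f, hf, rfl⟩ := isFunc_pointSetCode_iff.1 hφ
    have e : f = fun _ => x := funext fun s =>
      (pair_mem_funCode.1 (hs _ (mem_pointSetCode.2 ⟨s, Set.mem_univ _, rfl⟩))).symm
    subst e
    exact hC.eq_ultraCollapse hf hy

end Code

/-! ### Critical point and closure of the ultrapower -/

section UltrapowerEmbedding

variable {S : Type u} {W : Ultrafilter S} {κ : Cardinal.{u}}

theorem IsComplete.countableInterFilter (hW : IsComplete κ W) (hκ : ℵ₀ < κ) :
    CountableInterFilter (W : Filter S) :=
  have : CardinalInterFilter (W : Filter S) κ := hW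
  CardinalInterFilter.toCountableInterFilter _ hκ

/-- A `κ`-complete ultrafilter decides a function with fewer than `κ` values. -/
theorem IsComplete.exists_eventually_eq (hW : IsComplete κ W) {ι : Type u} (hι : #ι < κ)
    {p : S → ι → Prop} (h : ∀ᶠ s in (W : Filter S), ∃ i, p s i) :
    ∃ i, ∀ᶠ s in (W : Filter S), p s i := by
  have : CardinalInterFilter (W : Filter S) κ := hW
  by_contra! hcon
  have : ∀ᶠ s in (W : Filter S), ∀ i, ¬ p s i :=
    (eventually_cardinal_forall hι).2 fun i => hcon i
  obtain ⟨s, h1, i, h2⟩ := (this.and h).exists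
  exact h1 i h2

theorem IsComplete.exists_eventually_eq_toZFSet (hW : IsComplete κ W) {ξ : Ordinal.{u}}
    (hξ : ξ < κ.ord) {g : S → ZFSet.{u}} (hg : ∀ᶠ s in (W : Filter S), g s ∈ ξ.toZFSet) :
    ∃ ν < ξ, ∀ᶠ s in (W : Filter S), g s = ν.toZFSet := by
  have hι : #ξ.ToType < κ := by
    rw [mk_toType]
    exact lt_ord.1 hξ
  obtain ⟨i, hi⟩ := hW.exists_eventually_eq hι
    (p := fun s i => g s = (i.toOrd : Ordinal.{u}).toZFSet) (hg.mono fun s hs => by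
      obtain ⟨ν, hν, e⟩ := Ordinal.mem_toZFSet_iff.1 hs
      exact ⟨Ordinal.ToType.mk ⟨ν, hν⟩, by simp [e]⟩)
  exact ⟨_, i.toOrd.2, hi⟩

variable [CountableInterFilter (W : Filter S)]

theorem ultraEmbedding_toZFSet (hW : IsComplete κ W) {ξ : Ordinal.{u}} (hξ : ξ < κ.ord) :
    (ultraEmbedding W ξ.toZFSet : ZFSet.{u}) = ξ.toZFSet := by
  induction ξ using WellFoundedLT.induction with
  | _ ξ ih =>
  have ih' : ∀ ν < ξ, ultraCollapse W ((fun _ => ν.toZFSet : S → ZFSet.{u}) :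
      Germ (W : Filter S) ZFSet.{u}) = ν.toZFSet := fun ν hν => ih ν hν (hν.trans hξ)
  rw [ultraEmbedding_apply]
  ext y
  rw [mem_ultraCollapse, Ordinal.mem_toZFSet_iff]
  constructor
  · rintro ⟨g, hg, rfl⟩
    obtain ⟨g, rfl⟩ := Quotient.exists_rep g
    obtain ⟨ν, hν, e⟩ := hW.exists_eventually_eq_toZFSet hξ hg
    refine ⟨ν, hν, ?_⟩
    rw [← ih' ν hν]
    exact congrArg _ (Germ.coe_eq.2 (e.mono fun s hs => hs.symm))
  · rintro ⟨ν, hν, rfl⟩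
    refine ⟨_, ?_, ih' ν hν⟩
    exact (ultraMem_coe W).2 (Eventually.of_forall fun _ => Ordinal.toZFSet_mem_toZFSet_iff.2 hν)

theorem elementary_isOrdinal {M : Set ZFSet.{u}} (hM : TransClass M) (j : ZFSet.{u} ↪ₑ[memLang] M)
    (ξ : Ordinal.{u}) : (j ξ.toZFSet : ZFSet.{u}).IsOrdinal :=
  (Absolute.transfer j (P := fun v : Unit → ZFSet.{u} => (v ()).IsOrdinal) hM
    fun _ => ξ.toZFSet).1 (ZFSet.isOrdinal_toZFSet ξ)

theorem toZFSet_mem_ultraEmbedding (hW : IsComplete κ W)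
    (hne : (ultraEmbedding W κ.ord.toZFSet : ZFSet.{u}) ≠ κ.ord.toZFSet) :
    κ.ord.toZFSet ∈ (ultraEmbedding W κ.ord.toZFSet : ZFSet.{u}) := by
  have h1 : κ.ord.toZFSet ⊆ (ultraEmbedding W κ.ord.toZFSet : ZFSet.{u}) := by
    intro y hy
    obtain ⟨ν, hν, rfl⟩ := Ordinal.mem_toZFSet_iff.1 hy
    rw [← ultraEmbedding_toZFSet hW hν]
    exact ultraCollapse_mem_iff.2 (Eventually.of_forall fun _ => hy)
  exact (((ZFSet.isOrdinal_toZFSet _).subset_iff_eq_or_mem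
    (elementary_isOrdinal ultraClass_transitive _ _)).1 h1).resolve_left hne.symm

/-- Since `κ ∈ j(κ)`, some `h` represents `κ`. The sequence is represented by `G`, with `G s` the
set of pairs `(ν, F ν s)` for `ν ∈ h s`. -/
theorem codeSeq_mem_ultraClass (hW : IsComplete κ W)
    (hne : (ultraEmbedding W κ.ord.toZFSet : ZFSet.{u}) ≠ κ.ord.toZFSet)
    (f : Set.Iio κ.ord → ZFSet.{u}) (hf : ∀ ξ, f ξ ∈ ultraClass W) :
    codeSeq f ∈ ultraClass W := by
  obtain ⟨h, hh⟩ := ultraClass_transitive _ (ultraEmbedding W κ.ord.toZFSet).2 _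
    (toZFSet_mem_ultraEmbedding hW hne)
  obtain ⟨h, rfl⟩ := Quotient.exists_rep h
  have hF : ∀ ξ, ∃ F : S → ZFSet.{u}, ultraCollapse W F = f ξ := fun ξ => by
    obtain ⟨F, hF⟩ := hf ξ
    obtain ⟨F, rfl⟩ := Quotient.exists_rep F
    exact ⟨F, hF⟩
  choose F hF using hF
  let G : S → ZFSet.{u} := fun s => ZFSet.range
    fun ν : {ν : Set.Iio κ.ord // ν.1.toZFSet ∈ h s} => ZFSet.pair ν.1.1.toZFSet (F ν.1 s)
  have hpair : ∀ ν : Set.Iio κ.ord, ultraCollapse W ((fun s => ZFSet.pair ν.1.toZFSet (F ν s) :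
      S → ZFSet.{u}) : Germ (W : Filter S) ZFSet.{u}) = ZFSet.pair ν.1.toZFSet (f ν) := by
    intro ν
    have := (Absolute.ultraCollapse_iff (W := W)
      (P := fun v : Fin 3 → ZFSet.{u} => v 0 = ZFSet.pair (v 1) (v 2))
      ![fun s => ZFSet.pair ν.1.toZFSet (F ν s), fun _ => ν.1.toZFSet, F ν]).2
      (Eventually.of_forall fun _ => rfl)
    refine this.trans ?_
    rw [← hF ν]
    exact congrArg (fun z => ZFSet.pair z _) (ultraEmbedding_toZFSet hW ν.2)
  refine ⟨G, ?_⟩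
  ext y
  rw [mem_ultraCollapse, codeSeq, ZFSet.mem_range]
  constructor
  · rintro ⟨t, ht, rfl⟩
    obtain ⟨t, rfl⟩ := Quotient.exists_rep t
    have ht' : ∀ᶠ s in (W : Filter S), t s ∈ G s := ht
    have hν : ∀ s, ∃ ν : ZFSet.{u}, t s ∈ G s → ν ∈ h s ∧
        ∃ ξ : Set.Iio κ.ord, ξ.1.toZFSet = ν ∧ t s = ZFSet.pair ν (F ξ s) := by
      intro s
      by_cases hs : t s ∈ G s
      · obtain ⟨⟨ξ, hξ⟩, e⟩ := ZFSet.mem_range.1 hs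
        exact ⟨ξ.1.toZFSet, fun _ => ⟨hξ, ξ, rfl, e.symm⟩⟩
      · exact ⟨∅, fun h => absurd h hs⟩
    choose ν hν using hν
    -- The first coordinate of `t` represents an element of `κ`, hence is constant almost
    -- everywhere.
    have h1 : ultraCollapse W ν ∈ κ.ord.toZFSet := by
      rw [← hh]
      exact ultraCollapse_mem_iff.2 (ht'.mono fun s hs => (hν s hs).1)
    obtain ⟨ξ, hξ, e⟩ := Ordinal.mem_toZFSet_iff.1 h1
    rw [← ultraEmbedding_toZFSet hW hξ] at e
    have h2 : ∀ᶠ s in (W : Filter S), ξ.toZFSet = ν s :=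
      Germ.coe_eq.1 (ultraCollapse_injective e)
    refine ⟨⟨ξ, hξ⟩, ?_⟩
    rw [← hpair]
    refine congrArg _ (Germ.coe_eq.2 ?_)
    filter_upwards [h2, ht'] with s h2 h3
    obtain ⟨-, ξ', e1, e2⟩ := hν s h3
    rw [← h2] at e1 e2
    obtain rfl : ξ' = ⟨ξ, hξ⟩ := Subtype.ext (Ordinal.toZFSet_injective e1)
    exact e2.symm
  · rintro ⟨ν, rfl⟩
    refine ⟨_, ?_, hpair ν⟩
    have h1 : ν.1.toZFSet ∈ ultraCollapse W h := by
      have : ν.1.toZFSet ∈ κ.ord.toZFSet := Ordinal.toZFSet_mem_toZFSet_iff.2 ν.2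
      rwa [← hh] at this
    rw [← ultraEmbedding_toZFSet hW ν.2] at h1
    have h2 : ∀ᶠ s in (W : Filter S), ν.1.toZFSet ∈ h s := ultraCollapse_mem_iff.1 h1
    exact h2.mono fun s hs => ZFSet.mem_range.2 ⟨⟨ν, hs⟩, rfl⟩

theorem isGoodEmbedding_ultraEmbedding (hW : IsComplete κ W)
    (hne : (ultraEmbedding W κ.ord.toZFSet : ZFSet.{u}) ≠ κ.ord.toZFSet) :
    IsGoodEmbedding κ (ultraClass W) (ultraEmbedding W) where
  transitive := ultraClass_transitive
  definable := definable₂_ultraEmbedding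
  crit := ⟨hne, fun ξ hξ => by
    by_contra! hlt
    exact hξ (ultraEmbedding_toZFSet hW hlt)⟩
  closed := codeSeq_mem_ultraClass hW hne

end UltrapowerEmbedding

/-! ### Closure properties of the target of an elementary embedding -/

theorem exists_range (f : ZFSet.{u}) : ∃ r : ZFSet.{u}, ∀ y, y ∈ r ↔ ∃ x, ZFSet.pair x y ∈ f := by
  refine ⟨ZFSet.sep (fun y => ∃ x, ZFSet.pair x y ∈ f) (ZFSet.sUnion (ZFSet.sUnion f)), fun y => ?_⟩
  rw [ZFSet.mem_sep, and_iff_right_iff_imp]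
  rintro ⟨x, h⟩
  refine ZFSet.mem_sUnion.2 ⟨{x, y}, ZFSet.mem_sUnion.2 ⟨_, h, ?_⟩, by simp⟩
  simp [ZFSet.pair]

instance Absolute.isRange {ι : Type*} (i k : ι) :
    Absolute fun v : ι → ZFSet.{u} => ∀ y, y ∈ v i ↔ ∃ x, ZFSet.pair x y ∈ v k :=
  Absolute.congr (P := fun v => (∀ y ∈ v i, ∃ z ∈ v k, ∃ a ∈ z, ∃ x ∈ a, z = ZFSet.pair x y) ∧
    ∀ z ∈ v k, ∀ a ∈ z, ∀ x ∈ a, ∀ y ∈ a, z = ZFSet.pair x y → y ∈ v i) inferInstance fun v => by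
    have hx : ∀ x y : ZFSet.{u}, {x, y} ∈ ZFSet.pair x y := fun x y => by simp [ZFSet.pair]
    constructor
    · rintro ⟨h1, h2⟩ y
      refine ⟨fun hy => ?_, fun ⟨x, h⟩ => h2 _ h _ (hx x y) x (by simp) y (by simp) rfl⟩
      obtain ⟨z, hz, -, -, x, -, rfl⟩ := h1 y hy
      exact ⟨x, hz⟩
    · intro h
      refine ⟨fun y hy => ?_, ?_⟩
      · obtain ⟨x, h⟩ := (h y).1 hy
        exact ⟨_, h, _, hx x y, x, by simp, rfl⟩
      · rintro _ hz a - x - y - rfl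
        exact (h y).2 ⟨x, hz⟩

section Elementary

variable {M : Set ZFSet.{u}} (hM : TransClass M) (j : ZFSet.{u} ↪ₑ[memLang] M)
include hM

theorem elementary_mem_iff {x y : ZFSet.{u}} :
    x ∈ y ↔ (j x : ZFSet.{u}) ∈ (j y : ZFSet.{u}) :=
  Absolute.transfer j (P := fun v : Fin 2 → ZFSet.{u} => v 0 ∈ v 1) hM ![x, y]

theorem elementary_subset {x y : ZFSet.{u}} (h : x ⊆ y) :
    (j x : ZFSet.{u}) ⊆ (j y : ZFSet.{u}) :=
  (Absolute.transfer j (P := fun v : Fin 2 → ZFSet.{u} => v 0 ⊆ v 1) hM ![x, y]).1 h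

theorem elementary_pair (x y : ZFSet.{u}) :
    (j (ZFSet.pair x y) : ZFSet.{u}) = ZFSet.pair (j x) (j y) :=
  (Absolute.transfer j (P := fun v : Fin 3 → ZFSet.{u} => v 0 = ZFSet.pair (v 1) (v 2)) hM
    ![ZFSet.pair x y, x, y]).1 rfl

include j in
theorem pair_mem_class {x y : ZFSet.{u}} (hx : x ∈ M) (hy : y ∈ M) : ZFSet.pair x y ∈ M := by
  obtain ⟨z, hz⟩ := (Absolute.transfer_forall_exists j (ι := Empty) (β := Fin 2) (γ := Unit)
    (P := fun v => v (.inr ()) = ZFSet.pair (v (.inl (.inr 0))) (v (.inl (.inr 1)))) hM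
    (fun i => nomatch i)).1 (fun x => ⟨fun _ => ZFSet.pair (x 0) (x 1), rfl⟩)
    ![⟨x, hx⟩, ⟨y, hy⟩]
  have h : (z () : ZFSet.{u}) = ZFSet.pair x y := hz
  exact h ▸ (z ()).2

include j in
theorem exists_range_mem_class {f : ZFSet.{u}} (hf : f ∈ M) :
    ∃ r ∈ M, ∀ y, y ∈ r ↔ ∃ x, ZFSet.pair x y ∈ f := by
  obtain ⟨r, hr⟩ := (Absolute.transfer_forall_exists j (ι := Empty) (β := Unit) (γ := Unit)
    (P := fun v => ∀ y, y ∈ v (.inr ()) ↔ ∃ x, ZFSet.pair x y ∈ v (.inl (.inr ()))) hM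
    (fun i => nomatch i)).1 (fun f => by
      obtain ⟨r, hr⟩ := exists_range (f ())
      exact ⟨fun _ => r, hr⟩) fun _ => ⟨f, hf⟩
  exact ⟨r (), (r ()).2, hr⟩

include j in
-- `j` is strictly increasing on ordinals, so `ξ ≤ j(ξ) ∈ M`.
theorem toZFSet_mem_class (ξ : Ordinal.{u}) : ξ.toZFSet ∈ M := by
  have hmono : StrictMono fun ν : Ordinal.{u} => (j ν.toZFSet : ZFSet.{u}).rank := fun ν μ h =>
    ZFSet.rank_lt_of_mem ((elementary_mem_iff hM j).1 (Ordinal.toZFSet_mem_toZFSet_iff.2 h))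
  have h1 := hmono.le_apply (x := ξ)
  have h2 := elementary_isOrdinal hM j ξ
  rcases h1.eq_or_lt with h1 | h1
  · rw [h1, h2.toZFSet_rank_eq]
    exact (j _).2
  · refine hM _ (j ξ.toZFSet).2 _ ?_
    rw [← h2.toZFSet_rank_eq]
    exact Ordinal.toZFSet_mem_toZFSet_iff.2 h1

end Elementary

/-- A set of points of a small type with a given coding, as an element of `V`. -/
noncomputable def imageCode {D : Type u} (c : D → ZFSet.{u}) (Y : Set D) : ZFSet.{u} :=
  ZFSet.range fun d : Y => c d.1

theorem mem_imageCode {D : Type u} {c : D → ZFSet.{u}} {Y : Set D} {x : ZFSet.{u}} :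
    x ∈ imageCode c Y ↔ ∃ d ∈ Y, c d = x := by
  simp [imageCode]

theorem apply_mem_imageCode {D : Type u} {c : D → ZFSet.{u}} (hc : Function.Injective c)
    {Y : Set D} {d : D} : c d ∈ imageCode c Y ↔ d ∈ Y := by
  simp [mem_imageCode, hc.eq_iff]

/-! ### Derived ultrafilters, and seed sequences shorter than `κ⁺` -/

section Good

variable {κ : Cardinal.{u}} {M : Set ZFSet.{u}} {j : ZFSet.{u} ↪ₑ[memLang] M}

theorem IsGoodEmbedding.apply_toZFSet (hj : IsGoodEmbedding κ M j) {ξ : Ordinal.{u}}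
    (hξ : ξ < κ.ord) : (j ξ.toZFSet : ZFSet.{u}) = ξ.toZFSet := by
  by_contra h
  exact (hj.crit.2 h).not_gt hξ

/-- A point `a` of `j(D)` generates a `κ`-complete ultrafilter on `D`. -/
theorem IsGoodEmbedding.exists_ultrafilter (hj : IsGoodEmbedding κ M j) {D : Type u}
    {c : D → ZFSet.{u}} (hc : Function.Injective c) {a : ZFSet.{u}}
    (ha : a ∈ (j (imageCode c Set.univ) : ZFSet.{u})) :
    ∃ U : Ultrafilter D, (∀ Y, Y ∈ U ↔ a ∈ (j (imageCode c Y) : ZFSet.{u})) ∧ IsComplete κ U := by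
  have hM : TransClass M := hj.transitive
  let F : Filter D :=
    { sets := {Y | a ∈ (j (imageCode c Y) : ZFSet.{u})}
      univ_sets := ha
      sets_of_superset := fun {Y Z} hY hYZ => by
        refine elementary_subset hM j (fun x hx => ?_) hY
        obtain ⟨d, hd, rfl⟩ := mem_imageCode.1 hx
        exact (apply_mem_imageCode hc).2 (hYZ hd)
      inter_sets := fun {Y Z} hY hZ => by
        refine (Absolute.transfer j (P := fun v : Fin 3 → ZFSet.{u} =>
          ∀ x ∈ v 0, x ∈ v 1 → x ∈ v 2) hM
            ![imageCode c Y, imageCode c Z, imageCode c (Y ∩ Z)]).1 ?_ a hY hZ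
        intro x hx hx'
        obtain ⟨d, hd, rfl⟩ := mem_imageCode.1 hx
        exact (apply_mem_imageCode hc).2 ⟨hd, (apply_mem_imageCode hc).1 hx'⟩ }
  have hF : ∀ Y, Y ∈ F ↔ a ∈ (j (imageCode c Y) : ZFSet.{u}) := fun Y => Iff.rfl
  refine ⟨Ultrafilter.ofComplNotMemIff F fun Y => ?_, hF, ⟨fun S hS hSF => ?_⟩⟩
  · rw [hF, hF, not_iff_comm]
    refine (Absolute.transfer j (P := fun v : Fin 3 → ZFSet.{u} =>
      ∀ x ∈ v 0, (¬ x ∈ v 1) ↔ x ∈ v 2) hM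
        ![imageCode c Set.univ, imageCode c Y, imageCode c Yᶜ]).1 ?_ a ha
    intro x hx
    obtain ⟨d, -, rfl⟩ := mem_imageCode.1 hx
    exact (not_congr (apply_mem_imageCode hc)).trans
      (apply_mem_imageCode (Y := Yᶜ) hc).symm
  -- Completeness: enumerate the family in length `δ < κ`. As `j` fixes `δ` and every `ν < δ`, the
  -- image enumeration takes at `ν` the value `j` of the `ν`-th set, so `a` belongs to all its
  -- values.
  · obtain ⟨e⟩ : Nonempty ((#S).ord.ToType ≃ S) := Cardinal.eq.1 (by rw [mk_toType, card_ord])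
    have hδ : (#S).ord < κ.ord := ord_lt_ord.2 hS
    refine (Absolute.transfer j (P := fun v : Fin 5 → ZFSet.{u} => ∀ x ∈ v 0,
      (∀ ν ∈ v 1, ∃ y ∈ v 2, ZFSet.pair ν y ∈ v 3 ∧ x ∈ y) → x ∈ v 4) hM
      ![imageCode c Set.univ, (#S).ord.toZFSet, ZFSet.range fun i => imageCode c (e i).1,
        ZFSet.range fun i => ZFSet.pair (i.toOrd : Ordinal.{u}).toZFSet (imageCode c (e i).1),
        imageCode c (⋂₀ S)]).1 ?_ a ha ?_
    · intro x hx h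
      obtain ⟨d, -, rfl⟩ := mem_imageCode.1 hx
      refine (apply_mem_imageCode hc).2 fun Y hY => ?_
      obtain ⟨y, -, hy, hxy⟩ := h (((e.symm ⟨Y, hY⟩).toOrd : Ordinal.{u}).toZFSet)
        (Ordinal.toZFSet_mem_toZFSet_iff.2 (e.symm ⟨Y, hY⟩).toOrd.2)
      obtain ⟨i, hi⟩ := ZFSet.mem_range.1 hy
      obtain ⟨h1, rfl⟩ := ZFSet.pair_inj.1 hi
      have h2 : i = e.symm ⟨Y, hY⟩ :=
        Ordinal.ToType.mk.symm.injective (Subtype.ext (Ordinal.toZFSet_injective h1))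
      rw [h2, Equiv.apply_symm_apply] at hxy
      exact (apply_mem_imageCode hc).1 hxy
    · intro ν hν
      have hν : ν ∈ (j (#S).ord.toZFSet : ZFSet.{u}) := hν
      rw [hj.apply_toZFSet hδ] at hν
      obtain ⟨ν, hν', rfl⟩ := Ordinal.mem_toZFSet_iff.1 hν
      let i : (#S).ord.ToType := Ordinal.ToType.mk ⟨ν, hν'⟩
      refine ⟨j (imageCode c (e i).1), (elementary_mem_iff hM j).1
        (ZFSet.mem_range.2 ⟨i, rfl⟩), ?_, hSF _ (e i).2⟩
      rw [← hj.apply_toZFSet (hν'.trans hδ), ← elementary_pair hM]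
      refine (elementary_mem_iff hM j).1 (ZFSet.mem_range.2 ⟨i, ?_⟩)
      simp [i]

variable {α : Ordinal.{u}} {U : Set.Iio α → Ultrafilter κ.ord.ToType}
  {η : Set.Iio α → Ordinal.{u}}

theorem Represents.mem_univ (hη : Represents U j η) (β : Set.Iio α) :
    (η β).toZFSet ∈ (j (codeSubset κ Set.univ) : ZFSet.{u}) :=
  (hη β Set.univ).1 Filter.univ_mem

/-- Seeds for a sequence of length less than `κ⁺` form a sequence in `M`. -/
theorem IsGoodEmbedding.codeSeq_mem (hj : IsGoodEmbedding κ M j) (h0 : 0 < α)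
    (hα : α < (Order.succ κ).ord) (hη : Represents U j η) :
    codeSeq (fun β => (η β).toZFSet) ∈ M := by
  have hM : TransClass M := hj.transitive
  have hcard : #(Set.Iio α) ≤ #(Set.Iio κ.ord) := by
    rw [Cardinal.mk_Iio_ordinal, Cardinal.mk_Iio_ordinal, Cardinal.lift_le, card_ord]
    exact Order.lt_succ_iff.1 (lt_ord.1 hα)
  obtain ⟨e⟩ := hcard
  have : Nonempty (Set.Iio α) := ⟨⟨0, h0⟩⟩
  let f : Set.Iio κ.ord → Set.Iio α := Function.invFun e
  have hf : Function.Surjective f := Function.invFun_surjective e.injective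
  -- Closure concerns sequences of length exactly `κ`, so the pairs `(β, η β)` are listed along a
  -- surjection from `κ`; the range of this list is the seed sequence.
  have h1 := hj.closed (fun ξ => ZFSet.pair (f ξ).1.toZFSet (η (f ξ)).toZFSet) fun ξ =>
    pair_mem_class hM j (toZFSet_mem_class hM j _) (hM _ (j _).2 _ (hη.mem_univ _))
  obtain ⟨r, hr, hr'⟩ := exists_range_mem_class hM j h1
  convert hr
  ext y
  rw [hr', codeSeq, ZFSet.mem_range]
  simp only [codeSeq, ZFSet.mem_range, ZFSet.pair_inj]
  constructor
  · rintro ⟨β, rfl⟩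
    obtain ⟨ξ, rfl⟩ := hf β
    exact ⟨_, ξ, rfl, rfl⟩
  · rintro ⟨_, ξ, -, rfl⟩
    exact ⟨f ξ, rfl⟩

end Good

theorem HasGP.hasSuperGP {κ : Cardinal.{u}} {α : Ordinal.{u}} (h0 : 0 < α)
    (hα : α < (Order.succ κ).ord) (h : HasGP κ α) : HasSuperGP κ α := by
  intro U hU
  obtain ⟨M, j, η, hj, hmono, hη⟩ := h U hU
  exact ⟨M, j, η, hj, hmono, hη, hj.codeSeq_mem h0 hα hη⟩

/-! ### Measurable cardinals are strong limits; almost disjoint codes -/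

section Measurable

variable {κ : Cardinal.{u}} {X : Type u} {D : Ultrafilter X}

theorem IsComplete.notMem_of_mk_lt (hD : IsComplete κ D) (hn : IsNonprincipal D)
    {s : Set X} (hs : #s < κ) : s ∉ D := by
  intro h
  obtain ⟨i, hi⟩ := hD.exists_eventually_eq hs (p := fun x (i : s) => x = i)
    (mem_of_superset h fun x hx => ⟨⟨x, hx⟩, rfl⟩)
  exact hn i hi

/-- Otherwise `κ` injects into the subsets of `c`; completeness decides all `c` coordinates at once,
and the resulting large set has at most one point. -/
theorem IsComplete.two_power_lt {D : Ultrafilter κ.ord.ToType} (hD : IsComplete κ D)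
    (hn : IsNonprincipal D) {c : Cardinal.{u}} (hc : c < κ) : 2 ^ c < κ := by
  by_contra! h
  have h1 : #κ.ord.ToType ≤ #(Set c.out) := by rwa [mk_toType, card_ord, mk_set, mk_out]
  obtain ⟨f⟩ := h1
  have : CardinalInterFilter (D : Filter κ.ord.ToType) κ := hD
  obtain ⟨s, hs⟩ : ∃ s : Set c.out, ∀ i, ∀ᶠ x in (D : Filter _), i ∈ f x ↔ i ∈ s := by
    refine ⟨{i | ∀ᶠ x in (D : Filter _), i ∈ f x}, fun i => ?_⟩
    by_cases hi : ∀ᶠ x in (D : Filter _), i ∈ f x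
    · exact hi.mono fun x hx => iff_of_true hx hi
    · exact (Ultrafilter.eventually_not.2 hi).mono fun x hx => iff_of_false hx hi
  have h2 : ∀ᶠ x in (D : Filter _), ∀ i, i ∈ f x ↔ i ∈ s :=
    (eventually_cardinal_forall (by rwa [mk_out])).2 hs
  obtain ⟨x, hx⟩ := h2.exists
  refine hn x (mem_of_superset h2 fun y hy => f.injective (Set.ext fun i => ?_))
  rw [hx, hy]

end Measurable

section Coding

variable {κ : Cardinal.{u}}

theorem mk_Iio_toType_lt (ξ : κ.ord.ToType) : #(Set.Iio ξ) < κ := by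
  simpa using Cardinal.mk_Iio_lt ξ (by simp)

theorem mk_Iic_toType_lt (hκ : ℵ₀ ≤ κ) (ξ : κ.ord.ToType) : #(Set.Iic ξ) < κ := by
  simpa using mk_Iic_lt ξ (by simp) (by simpa using hκ)

/-- `e A ξ` codes the pair `(ξ, A ∩ ξ)`. In the lexicographic order such pairs have fewer than `κ`
predecessors, `κ` being a strong limit, so they embed into `κ`. The first clause compares codes
across different sets; the second holds because codes beyond a point of difference of `A` and `A'`
record it. -/
theorem exists_lex_code (hκ : ℵ₀ ≤ κ) (hpow : ∀ c < κ, 2 ^ c < κ) :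
    ∃ e : Set κ.ord.ToType → κ.ord.ToType → κ.ord.ToType,
      (∀ A A' ξ ξ', ξ < ξ' → e A ξ < e A' ξ') ∧
      ∀ A A', A ≠ A' → ∃ ν, ∀ ξ > ν, ∀ ξ', e A ξ ≠ e A' ξ' := by
  let K := κ.ord.ToType
  let r : K × Set K → K × Set K → Prop := Prod.Lex (· < ·) WellOrderingRel
  let p : K × Set K → Prop := fun x => x.2 ⊆ Set.Iio x.1
  have hcard : ∀ x : Subtype p, #{y // Subrel r p y x} < κ := by
    intro x
    let g : {y // Subrel r p y x} → Set.Iic x.1.1 × Set (Set.Iio x.1.1) := fun y =>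
      (⟨y.1.1.1, by
        rcases Prod.lex_def.1 y.2 with h | h
        · exact h.le
        · exact h.1.le⟩, Subtype.val ⁻¹' y.1.1.2)
    have hle : ∀ y : {y // Subrel r p y x}, y.1.1.1 ≤ x.1.1 := fun y => (g y).1.2
    have hg : Function.Injective g := by
      rintro y z h
      obtain ⟨h1, h2⟩ := Prod.ext_iff.1 h
      refine Subtype.ext (Subtype.ext (Prod.ext (congrArg Subtype.val h1) (Set.ext fun i => ?_)))
      constructor
      · intro hi
        exact (Set.ext_iff.1 h2 ⟨i, (y.1.2 hi).trans_le (hle y)⟩).1 hi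
      · intro hi
        exact (Set.ext_iff.1 h2 ⟨i, (z.1.2 hi).trans_le (hle z)⟩).2 hi
    refine (mk_le_of_injective hg).trans_lt ?_
    rw [mk_prod, lift_id, lift_id, mk_set]
    exact mul_lt_of_lt hκ (mk_Iic_toType_lt hκ _) (hpow _ (mk_Iio_toType_lt _))
  have htype : Ordinal.type (Subrel r p) ≤ κ.ord := by
    refine le_of_forall_lt fun o ho => ?_
    obtain ⟨x, rfl⟩ := Ordinal.typein_surj _ ho
    rw [lt_ord]
    exact hcard x
  obtain ⟨E⟩ := Ordinal.type_le_iff'.1 (htype.trans_eq (Ordinal.type_toType κ.ord).symm)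
  let e : Set K → K → K := fun A ξ => E ⟨(ξ, A ∩ Set.Iio ξ), Set.inter_subset_right⟩
  have he : ∀ A A' ξ ξ', ξ < ξ' → e A ξ < e A' ξ' := fun A A' ξ ξ' h =>
    E.map_rel_iff.2 (Prod.Lex.left _ _ h)
  refine ⟨e, he, fun A A' hne => ?_⟩
  obtain ⟨ν, hν⟩ : ∃ ν, ¬ (ν ∈ A ↔ ν ∈ A') := by
    by_contra! h
    exact hne (Set.ext h)
  refine ⟨ν, fun ξ hξ ξ' heq => hν ?_⟩
  have h1 : ξ = ξ' := by
    rcases lt_trichotomy ξ ξ' with h | h | h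
    · exact absurd heq (he A A' _ _ h).ne
    · exact h
    · exact absurd heq.symm (he A' A _ _ h).ne
  subst h1
  have h2 := (Prod.ext_iff.1 (Subtype.ext_iff.1 (E.injective heq))).2
  have h3 := Set.ext_iff.1 h2 ν
  simpa [show ν < ξ from hξ] using h3

end Coding

/-! ### The `n`-th element of a set, and truncation to `κ^{<κ}` -/

section Nth

variable {K : Type u} [LinearOrder K]

/-- `ζ` is the `n`-th element of `R ∩ P`. -/
def IsNth : ℕ → Set K → Set K → K → Prop
  | 0, P, R, ζ => ζ ∈ R ∧ ζ ∈ P ∧ ∀ w < ζ, w ∈ R → w ∉ P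
  | n + 1, P, R, ζ => ζ ∈ R ∧ ζ ∈ P ∧ ∃ ζ' < ζ, IsNth n P R ζ' ∧ ∀ w < ζ, w ∈ R → w ∈ P → w ≤ ζ'

variable {P R : Set K} {n : ℕ} {ζ ζ' : K}

theorem IsNth.mem_right (h : IsNth n P R ζ) : ζ ∈ P := by
  cases n <;> exact h.2.1

theorem IsNth.unique (h : IsNth n P R ζ) (h' : IsNth n P R ζ') : ζ = ζ' := by
  induction n generalizing ζ ζ' with
  | zero =>
    rcases lt_trichotomy ζ ζ' with hlt | e | hlt
    · exact absurd h.2.1 (h'.2.2 _ hlt h.1)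
    · exact e
    · exact absurd h'.2.1 (h.2.2 _ hlt h'.1)
  | succ n ih =>
    obtain ⟨hR, hP, x, hx, hn, hw⟩ := h
    obtain ⟨hR', hP', x', hx', hn', hw'⟩ := h'
    obtain rfl := ih hn hn'
    rcases lt_trichotomy ζ ζ' with hlt | e | hlt
    · exact absurd (hw' _ hlt hR hP) hx.not_ge
    · exact e
    · exact absurd (hw _ hlt hR' hP') hx'.not_ge

theorem IsNth.inter_Iio (h : IsNth n P R ζ) {ξ : K} (hξ : ζ < ξ) :
    IsNth n P (R ∩ Set.Iio ξ) ζ := by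
  induction n generalizing ζ with
  | zero => exact ⟨⟨h.1, hξ⟩, h.2.1, fun w hw hR => h.2.2 w hw hR.1⟩
  | succ n ih =>
    obtain ⟨hR, hP, x, hx, hn, hw⟩ := h
    exact ⟨⟨hR, hξ⟩, hP, x, hx, ih hn (hx.trans hξ), fun w hwζ hR => hw w hwζ hR.1⟩

end Nth

section Truncate

variable {κ : Cardinal.{u}}

/-- Every ultrafilter on `P(κ)` has a counterpart on `κ^{<κ}`: the bounded pieces of a typical
subset of `κ`, with the bound chosen by a measure on `κ`. -/
theorem exists_ultrafilter_seqLT (hκ : ℵ₀ < κ) {D : Ultrafilter κ.ord.ToType}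
    (hD : IsComplete κ D) (hn : IsNonprincipal D) {E : Ultrafilter (Set κ.ord.ToType)}
    (hE : IsComplete κ E) :
    ∃ (W : Ultrafilter (SeqLT κ)) (r : SeqLT κ → Set κ.ord.ToType), IsComplete κ W ∧
      ∀ Q : Set κ.ord.ToType → Prop, (∀ R, Q R → ∃ ζ, ∀ ξ > ζ, Q (R ∩ Set.Iio ξ)) →
        (∀ᶠ R in (E : Filter _), Q R) → ∀ᶠ s in (W : Filter _), Q (r s) := by
  classical
  have : Nontrivial κ.ord.ToType := by
    rw [← one_lt_iff_nontrivial, mk_toType, card_ord]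
    exact one_lt_aleph0.trans hκ
  obtain ⟨k, k', hk⟩ := exists_pair_ne κ.ord.ToType
  -- `t R ξ` is the characteristic function of `R ∩ ξ`, decoded by `r`. The ultrafilter `W` says:
  -- for `E`-many `R`, for `D`-many `ξ`. As `D` contains no bounded set, `ξ` may be taken beyond any
  -- given bound.
  let t : Set κ.ord.ToType → κ.ord.ToType → SeqLT κ := fun R ξ =>
    ⟨ξ, fun ν => if ν.1 ∈ R then k else k'⟩
  let r : SeqLT κ → Set κ.ord.ToType := fun s => {ν | ∃ h : ν < s.1, s.2 ⟨ν, h⟩ = k}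
  have hr : ∀ R ξ, r (t R ξ) = R ∩ Set.Iio ξ := by
    intro R ξ
    ext ν
    by_cases hν : ν ∈ R <;> simp [r, t, hν, hk.symm]
  have hW : ∀ X, X ∈ E.bind (fun R => D.map (t R)) ↔
      ∀ᶠ R in (E : Filter _), ∀ᶠ ξ in (D : Filter _), t R ξ ∈ X := fun X => Iff.rfl
  refine ⟨E.bind fun R => D.map (t R), r, ⟨fun S hS h => ?_⟩, fun Q hQ h => ?_⟩
  · have : CardinalInterFilter (D : Filter κ.ord.ToType) κ := hD
    have : CardinalInterFilter (E : Filter (Set κ.ord.ToType)) κ := hE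
    refine (hW _).2 ?_
    simp only [Set.mem_sInter]
    refine ((eventually_cardinal_ball hS).2 fun X hX => (hW X).1 (h X hX)).mono fun R hR => ?_
    exact (eventually_cardinal_ball hS).2 hR
  · refine (hW _).2 (h.mono fun R hR => ?_)
    obtain ⟨ζ, hζ⟩ := hQ R hR
    have h1 : Set.Iic ζ ∉ D := hD.notMem_of_mk_lt hn (mk_Iic_toType_lt hκ.le ζ)
    rw [← Ultrafilter.compl_mem_iff_notMem] at h1
    refine mem_of_superset h1 fun ξ hξ => ?_
    have := hζ ξ (by simpa using hξ)
    rw [← hr] at this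
    exact this

end Truncate

/-! ### Recovering the seeds from the set of seeds -/

section Seeds

variable {κ : Cardinal.{u}}

/-- An ordinal below `κ`, as an element of `V`. -/
noncomputable def ordCode (κ : Cardinal.{u}) (ξ : κ.ord.ToType) : ZFSet.{u} :=
  (ξ.toOrd : Ordinal.{u}).toZFSet

theorem ordCode_injective : Function.Injective (ordCode κ) := fun _ _ h =>
  Ordinal.ToType.mk.symm.injective (Subtype.ext (Ordinal.toZFSet_injective h))

theorem ordCode_mem_ordCode {ξ ζ : κ.ord.ToType} : ordCode κ ξ ∈ ordCode κ ζ ↔ ξ < ζ := by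
  rw [ordCode, ordCode, Ordinal.toZFSet_mem_toZFSet_iff, Subtype.coe_lt_coe]
  exact Ordinal.ToType.mk.symm.lt_iff_lt

theorem mem_ordCode {ζ : κ.ord.ToType} {x : ZFSet.{u}} :
    x ∈ ordCode κ ζ ↔ ∃ ξ < ζ, ordCode κ ξ = x := by
  constructor
  · intro h
    obtain ⟨o, ho, rfl⟩ := Ordinal.mem_toZFSet_iff.1 h
    have e : ordCode κ (Ordinal.ToType.mk ⟨o, ho.trans ζ.toOrd.2⟩) = o.toZFSet := by
      simp [ordCode]
    refine ⟨_, ?_, e⟩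
    rw [← ordCode_mem_ordCode, e]
    exact h
  · rintro ⟨ξ, h, rfl⟩
    exact ordCode_mem_ordCode.2 h

theorem mem_codeSubset {X : Set κ.ord.ToType} {x : ZFSet.{u}} :
    x ∈ codeSubset κ X ↔ ∃ ξ ∈ X, ordCode κ ξ = x := mem_imageCode (c := ordCode κ)

theorem ordCode_mem_codeSubset {X : Set κ.ord.ToType} {ξ : κ.ord.ToType} :
    ordCode κ ξ ∈ codeSubset κ X ↔ ξ ∈ X := apply_mem_imageCode ordCode_injective

theorem codeSubset_injective : Function.Injective (codeSubset κ) := fun X Y h => by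
  ext ξ
  rw [← ordCode_mem_codeSubset, h, ordCode_mem_codeSubset]

theorem codeSubset_univ : codeSubset κ Set.univ = κ.ord.toZFSet := by
  ext x
  rw [mem_codeSubset, Ordinal.mem_toZFSet_iff]
  constructor
  · rintro ⟨ξ, -, rfl⟩
    exact ⟨_, ξ.toOrd.2, rfl⟩
  · rintro ⟨o, ho, rfl⟩
    exact ⟨Ordinal.ToType.mk ⟨o, ho⟩, trivial, by simp [ordCode]⟩

theorem exists_codeSubset_eq {x : ZFSet.{u}} (hx : x ⊆ codeSubset κ Set.univ) :
    ∃ X, codeSubset κ X = x := by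
  refine ⟨{ξ | ordCode κ ξ ∈ x}, ?_⟩
  ext y
  rw [mem_codeSubset]
  constructor
  · rintro ⟨ξ, hξ, rfl⟩
    exact hξ
  · intro hy
    obtain ⟨ξ, -, rfl⟩ := mem_codeSubset.1 (hx hy)
    exact ⟨ξ, hy, rfl⟩

/-- A relation between subsets and elements of `κ`, as an element of `V`. -/
noncomputable def relCode (T : Set (Set κ.ord.ToType × κ.ord.ToType)) : ZFSet.{u} :=
  imageCode (fun t => ZFSet.pair (codeSubset κ t.1) (ordCode κ t.2)) T

theorem pair_mem_relCode {T : Set (Set κ.ord.ToType × κ.ord.ToType)} {R : Set κ.ord.ToType}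
    {ζ : κ.ord.ToType} :
    ZFSet.pair (codeSubset κ R) (ordCode κ ζ) ∈ relCode T ↔ (R, ζ) ∈ T :=
  apply_mem_imageCode (c := fun t : Set κ.ord.ToType × κ.ord.ToType =>
    ZFSet.pair (codeSubset κ t.1) (ordCode κ t.2)) (d := (R, ζ)) fun s t h => by
    obtain ⟨h1, h2⟩ := ZFSet.pair_inj.1 h
    exact Prod.ext (codeSubset_injective h1) (ordCode_injective h2)

variable {α : Ordinal.{u}} {M : Set ZFSet.{u}} {j : ZFSet.{u} ↪ₑ[memLang] M}
  {U : Set.Iio α → Ultrafilter κ.ord.ToType} {η : Set.Iio α → Ordinal.{u}}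

/-- The ultrafilter on `P(κ)` generated by the set of seeds. The relation `Seed P n β` says that
the seed of index `β` is the `n`-th one in `j(P)`. -/
theorem exists_ultrafilter_of_seeds (hj : IsGoodEmbedding κ M j) (hmono : StrictMono η)
    (hη : Represents U j η) (hmem : codeSeq (fun β => (η β).toZFSet) ∈ M) :
    ∃ (E : Ultrafilter (Set κ.ord.ToType)) (Seed : Set κ.ord.ToType → ℕ → Set.Iio α → Prop),
      IsComplete κ E ∧
      (∀ P β, P ∈ U β → (∀ δ < β, P ∉ U δ) → Seed P 0 β) ∧
      (∀ P n δ β, P ∈ U β → δ < β → Seed P n δ → (∀ ε < β, P ∈ U ε → ε ≤ δ) →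
        Seed P (n + 1) β) ∧
      (∀ P n β X, Seed P n β → X ∈ U β → ∀ᶠ R in (E : Filter _), ∃ ζ ∈ X, IsNth n P R ζ) ∧
      ∀ P n β P' n' β', Seed P n β → Seed P' n' β' → β < β' →
        ∀ᶠ R in (E : Filter _), ∃ ζ ζ', ζ < ζ' ∧ IsNth n P R ζ ∧ IsNth n' P' R ζ' := by
  have hM : TransClass M := hj.transitive
  obtain ⟨a, haM, ha⟩ := exists_range_mem_class hM j hmem
  replace ha : ∀ y, y ∈ a ↔ ∃ β, (η β).toZFSet = y := fun y => by
    rw [ha]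
    simp only [codeSeq, ZFSet.mem_range, ZFSet.pair_inj]
    exact ⟨fun ⟨_, β, _, h⟩ => ⟨β, h⟩, fun ⟨β, h⟩ => ⟨_, β, rfl, h⟩⟩
  set p : ZFSet.{u} := imageCode (codeSubset κ) Set.univ with hp
  set k : ZFSet.{u} := codeSubset κ Set.univ with hk
  -- The only use of the seed sequence being in `M`: its range `a` is a subset of `j(κ)` in `M`,
  -- hence in `j(P(κ))`.
  have hap : a ∈ (j p : ZFSet.{u}) := by
    obtain ⟨z, hz⟩ := (Absolute.transfer_forall_exists j (ι := Fin 2) (β := Unit) (γ := Empty)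
      (P := fun v => v (.inl (.inr ())) ⊆ v (.inl (.inl 0)) →
        v (.inl (.inr ())) ∈ v (.inl (.inl 1))) hM ![k, p]).1 (fun x => by
        refine ⟨Empty.elim, fun hx => ?_⟩
        obtain ⟨X, hX⟩ := exists_codeSubset_eq hx
        exact mem_imageCode.2 ⟨X, trivial, hX⟩) fun _ => ⟨a, haM⟩
    refine hz fun y hy => ?_
    obtain ⟨β, rfl⟩ := (ha _).1 hy
    exact hη.mem_univ β
  obtain ⟨E, hE, hEc⟩ := hj.exists_ultrafilter codeSubset_injective hap
  let N : Set κ.ord.ToType → ℕ → ZFSet.{u} := fun P n => relCode {t | IsNth n P t.1 t.2}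
  have hk' : ∀ β, (η β).toZFSet ∈ (j k : ZFSet.{u}) := hη.mem_univ
  have hlt : ∀ {β w}, w ∈ (η β).toZFSet → w ∈ a → ∃ δ < β, (η δ).toZFSet = w := by
    intro β w hw hwa
    obtain ⟨δ, rfl⟩ := (ha _).1 hwa
    exact ⟨δ, hmono.lt_iff_lt.1 (Ordinal.toZFSet_mem_toZFSet_iff.1 hw), rfl⟩
  refine ⟨E, fun P n β => ZFSet.pair a (η β).toZFSet ∈ (j (N P n) : ZFSet.{u}), hEc,
    fun P β hP h => ?_, fun P n δ β hP hδ hS h => ?_, fun P n β X hS hX => (hE _).2 ?_,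
    fun P n β P' n' β' hS hS' hβ => (hE _).2 ?_⟩
  -- In each of the four clauses, a bounded statement about all `R ⊆ κ` and `ζ < κ` is moved along
  -- `j` and instantiated at `R = a` and `ζ = η β`.
  · refine (Absolute.transfer j (P := fun v : Fin 4 → ZFSet.{u} => ∀ R ∈ v 0, ∀ ζ ∈ v 1, ζ ∈ R →
      ζ ∈ v 2 → (∀ w ∈ ζ, w ∈ R → ¬ w ∈ v 2) → ZFSet.pair R ζ ∈ v 3) hM
      ![p, k, codeSubset κ P, N P 0]).1 ?_ a hap _ (hk' β) ((ha _).2 ⟨β, rfl⟩) ((hη β P).1 hP) ?_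
    · intro R hR ζ hζ h1 h2 h3
      obtain ⟨R, -, rfl⟩ := mem_imageCode.1 hR
      obtain ⟨ζ, -, rfl⟩ := mem_codeSubset.1 hζ
      exact pair_mem_relCode.2 ⟨ordCode_mem_codeSubset.1 h1, ordCode_mem_codeSubset.1 h2,
        fun w hw hwR hwP => h3 _ (ordCode_mem_ordCode.2 hw) (ordCode_mem_codeSubset.2 hwR)
          (ordCode_mem_codeSubset.2 hwP)⟩
    · intro w hw hwa hwP
      obtain ⟨δ, hδ, rfl⟩ := hlt hw hwa
      exact h δ hδ ((hη δ P).2 hwP)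
  · refine (Absolute.transfer j (P := fun v : Fin 5 → ZFSet.{u} => ∀ R ∈ v 0, ∀ ζ ∈ v 1, ζ ∈ R →
      ζ ∈ v 2 → ∀ ζ' ∈ ζ, ZFSet.pair R ζ' ∈ v 3 →
        (∀ w ∈ ζ, w ∈ R → w ∈ v 2 → w ∈ ζ' ∨ w = ζ') → ZFSet.pair R ζ ∈ v 4) hM
      ![p, k, codeSubset κ P, N P n, N P (n + 1)]).1 ?_ a hap _ (hk' β) ((ha _).2 ⟨β, rfl⟩)
        ((hη β P).1 hP) _ (Ordinal.toZFSet_mem_toZFSet_iff.2 (hmono hδ)) hS ?_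
    · intro R hR ζ hζ h1 h2 ζ' hζ' h3 h4
      obtain ⟨R, -, rfl⟩ := mem_imageCode.1 hR
      obtain ⟨ζ, -, rfl⟩ := mem_codeSubset.1 hζ
      obtain ⟨ζ', hζζ', rfl⟩ := mem_ordCode.1 hζ'
      refine pair_mem_relCode.2 ⟨ordCode_mem_codeSubset.1 h1, ordCode_mem_codeSubset.1 h2, ζ',
        hζζ', pair_mem_relCode.1 h3, fun w hw hwR hwP => ?_⟩
      rcases h4 _ (ordCode_mem_ordCode.2 hw) (ordCode_mem_codeSubset.2 hwR)
        (ordCode_mem_codeSubset.2 hwP) with h5 | h5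
      · exact (ordCode_mem_ordCode.1 h5).le
      · exact (ordCode_injective h5).le
    · intro w hw hwa hwP
      obtain ⟨ε, hε, rfl⟩ := hlt hw hwa
      rcases (h ε hε ((hη ε P).2 hwP)).lt_or_eq with h5 | rfl
      · exact Or.inl (Ordinal.toZFSet_mem_toZFSet_iff.2 (hmono h5))
      · exact Or.inr rfl
  · refine (Absolute.transfer j (P := fun v : Fin 5 → ZFSet.{u} => ∀ R ∈ v 0, ∀ ζ ∈ v 1,
      ZFSet.pair R ζ ∈ v 2 → ζ ∈ v 3 → R ∈ v 4) hM
      ![p, k, N P n, codeSubset κ X, imageCode (codeSubset κ) {R | ∃ ζ ∈ X, IsNth n P R ζ}]).1 ?_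
      a hap _ (hk' β) hS ((hη β X).1 hX)
    intro R hR ζ hζ h1 h2
    obtain ⟨R, -, rfl⟩ := mem_imageCode.1 hR
    obtain ⟨ζ, -, rfl⟩ := mem_codeSubset.1 hζ
    exact (apply_mem_imageCode codeSubset_injective).2
      ⟨ζ, ordCode_mem_codeSubset.1 h2, pair_mem_relCode.1 h1⟩
  · refine (Absolute.transfer j (P := fun v : Fin 5 → ZFSet.{u} => ∀ R ∈ v 0, ∀ ζ ∈ v 1,
      ∀ ζ' ∈ v 1, ζ ∈ ζ' → ZFSet.pair R ζ ∈ v 2 → ZFSet.pair R ζ' ∈ v 3 → R ∈ v 4) hM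
      ![p, k, N P n, N P' n', imageCode (codeSubset κ)
        {R | ∃ ζ ζ', ζ < ζ' ∧ IsNth n P R ζ ∧ IsNth n' P' R ζ'}]).1 ?_
      a hap _ (hk' β) _ (hk' β') (Ordinal.toZFSet_mem_toZFSet_iff.2 (hmono hβ)) hS hS'
    intro R hR ζ hζ ζ' hζ' h0 h1 h2
    obtain ⟨R, -, rfl⟩ := mem_imageCode.1 hR
    obtain ⟨ζ, -, rfl⟩ := mem_codeSubset.1 hζ
    obtain ⟨ζ', -, rfl⟩ := mem_codeSubset.1 hζ'
    exact (apply_mem_imageCode codeSubset_injective).2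
      ⟨ζ, ζ', ordCode_mem_ordCode.1 h0, pair_mem_relCode.1 h1, pair_mem_relCode.1 h2⟩

/-- An ultrapower glues a sequence of ultrafilters as soon as they are the images of the given one
under an increasing sequence of functions. -/
theorem exists_glue_of_ultrafilter {S : Type u} {W : Ultrafilter S} (hκ : ℵ₀ < κ)
    (hW : IsComplete κ W) (h0 : 0 < α) (hU : ∀ β, IsNonprincipal (U β))
    (F : Set.Iio α → S → κ.ord.ToType) (hF : ∀ β, W.map (F β) = U β)
    (hlt : ∀ β β', β < β' → ∀ᶠ s in (W : Filter S), F β s < F β' s) :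
    ∃ (M : Set ZFSet.{u}) (j : ZFSet.{u} ↪ₑ[memLang] M) (η : Set.Iio α → Ordinal.{u}),
      IsGoodEmbedding κ M j ∧ StrictMono η ∧ Represents U j η ∧ IsUltrapowerEmbedding W j := by
  have := hW.countableInterFilter hκ
  let t : Set.Iio α → ZFSet.{u} := fun β => ultraCollapse W ((fun s => ordCode κ (F β s) :
    S → ZFSet.{u}) : Germ (W : Filter S) ZFSet.{u})
  have ht : ∀ β X, X ∈ U β ↔ t β ∈ (ultraEmbedding W (codeSubset κ X) : ZFSet.{u}) := by
    intro β X
    rw [ultraEmbedding_apply, ultraCollapse_mem_iff, ultraMem_coe, ← hF, Ultrafilter.mem_map]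
    simp only [ordCode_mem_codeSubset]
    rfl
  have hmem : ∀ β, t β ∈ (ultraEmbedding W κ.ord.toZFSet : ZFSet.{u}) := fun β => by
    rw [← codeSubset_univ]
    exact (ht β _).1 Filter.univ_mem
  have hord : ∀ β, (t β).IsOrdinal := fun β =>
    (elementary_isOrdinal ultraClass_transitive _ _).mem (hmem β)
  have hrank : ∀ β, (t β).rank.toZFSet = t β := fun β => (hord β).toZFSet_rank_eq
  refine ⟨_, ultraEmbedding W, fun β => (t β).rank, isGoodEmbedding_ultraEmbedding hW ?_, ?_, ?_,
    isUltrapowerEmbedding_ultraEmbedding⟩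
  -- If `j(κ) = κ`, the first seed is some `ν = j(ν)` below `κ`, so `F 0` is constant almost
  -- everywhere and `U 0` is principal.
  · intro e
    have h1 := hmem ⟨0, h0⟩
    rw [e] at h1
    obtain ⟨ν, hν, h2⟩ := Ordinal.mem_toZFSet_iff.1 h1
    rw [← ultraEmbedding_toZFSet hW hν] at h2
    have h3 : ∀ᶠ s in (W : Filter S), ν.toZFSet = ordCode κ (F ⟨0, h0⟩ s) :=
      Germ.coe_eq.1 (ultraCollapse_injective h2)
    refine hU ⟨0, h0⟩ (Ordinal.ToType.mk ⟨ν, hν⟩) ?_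
    rw [← hF, Ultrafilter.mem_map]
    refine mem_of_superset h3 fun s hs => ordCode_injective (hs.symm.trans ?_)
    simp [ordCode]
  · intro β β' h
    rw [← Ordinal.toZFSet_mem_toZFSet_iff, hrank, hrank]
    refine ultraCollapse_mem_iff.2 ((ultraMem_coe W).2 ((hlt β β' h).mono fun s hs => ?_))
    exact ordCode_mem_ordCode.2 hs
  · intro β X
    rw [hrank]
    exact ht β X

end Seeds

/-! ### From super gluing to gluing via ultrafilters -/

section Main

variable {κ : Cardinal.{u}} {α : Ordinal.{u}}

theorem exists_injective_Iio (hα : α < (Order.succ (Order.succ κ)).ord) :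
    ∃ A : Set.Iio α → Set κ.ord.ToType, Function.Injective A := by
  have h1 : α.card ≤ 2 ^ κ := by
    have h2 : α.card ≤ Order.succ κ := Order.lt_succ_iff.1 (lt_ord.1 hα)
    exact h2.trans (Order.succ_le_of_lt (cantor κ))
  have h2 : lift.{u} #(Set.Iio α) ≤ lift.{u + 1} #(Set κ.ord.ToType) := by
    rw [Cardinal.mk_Iio_ordinal, mk_set, mk_toType, card_ord, Cardinal.lift_id'.{u, u + 1},
      Cardinal.lift_le]
    exact h1
  obtain ⟨f⟩ := lift_mk_le'.1 h2
  exact ⟨f, f.injective⟩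

theorem HasSuperGP.hasGPViaUltrafilters (hκ : IsMeasurableCardinal κ) (h0 : 0 < α)
    (hα : α < (Order.succ (Order.succ κ)).ord) (h : HasSuperGP κ α) :
    HasGPViaUltrafilters κ α := by
  classical
  obtain ⟨hκ, D, hD, hDn⟩ := hκ
  intro U hU
  obtain ⟨e, he, hed⟩ := exists_lex_code hκ.le fun c hc => hD.two_power_lt hDn hc
  obtain ⟨A, hA⟩ := exists_injective_Iio hα
  have he' : ∀ A, StrictMono (e A) := fun A ξ ξ' => he A A ξ ξ'
  -- Tags are shared by blocks of length `ω`, rather than given to single indices, because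
  -- comparison across distinct tags yields only `F β ≤ F β'`; under a common tag it is strict.
  let b : Set.Iio α → Set.Iio α := fun β =>
    ⟨β.1 / Ordinal.omega0, lt_of_le_of_lt (Ordinal.div_le_of_le_mul
      (le_mul_of_one_le_left' (Order.one_le_iff_pos.2 Ordinal.omega0_pos))) β.2⟩
  let g : Set.Iio α → κ.ord.ToType → κ.ord.ToType := fun β => e (A (b β))
  have hg : ∀ β, Function.Injective (g β) := fun β => (he' _).injective
  let P : Set.Iio α → Set κ.ord.ToType := fun β => Set.range (g β)
  let U' : Set.Iio α → Ultrafilter κ.ord.ToType := fun β => (U β).map (g β)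
  have hU' : ∀ β, IsComplete κ (U' β) ∧ IsNonprincipal (U' β) := fun β => by
    refine ⟨?_, fun ζ hζ => ?_⟩
    · have : CardinalInterFilter (U β : Filter κ.ord.ToType) κ := (hU β).1
      exact inferInstanceAs (CardinalInterFilter (Filter.map (g β) (U β : Filter κ.ord.ToType)) κ)
    · obtain ⟨ξ, hξ⟩ := Ultrafilter.nonempty_of_mem (Ultrafilter.mem_map.1 hζ)
      refine (hU β).2 ξ (mem_of_superset (Ultrafilter.mem_map.1 hζ) fun ξ' hξ' => hg β ?_)
      exact (Set.mem_singleton_iff.1 hξ').trans (Set.mem_singleton_iff.1 hξ).symm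
  have hP : ∀ β δ, P β ∈ U' δ ↔ b β = b δ := by
    intro β δ
    constructor
    · intro hβ
      by_contra hne
      obtain ⟨ν, hν⟩ := hed (A (b δ)) (A (b β)) fun h => hne (hA h).symm
      refine (hU δ).1.notMem_of_mk_lt (hU δ).2 (mk_Iic_toType_lt hκ.le ν)
        (mem_of_superset (Ultrafilter.mem_map.1 hβ) ?_)
      rintro ξ ⟨ξ', hξ'⟩
      by_contra hlt
      exact hν ξ (not_le.1 hlt) ξ' hξ'.symm
    · intro hb
      have : P β = P δ := by simp only [P, g, hb]
      rw [this]
      exact Ultrafilter.mem_map.2 (univ_mem' fun ξ => ⟨ξ, rfl⟩)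
  have hmod : ∀ β : Set.Iio α, ∃ n : ℕ, β.1 % Ordinal.omega0 = n := fun β =>
    Ordinal.lt_omega0.1 (Ordinal.mod_lt _ Ordinal.omega0_ne_zero)
  choose n hn using hmod
  have hdm : ∀ β : Set.Iio α, β.1 = Ordinal.omega0 * (b β).1 + n β := fun β => by
    rw [← hn β]
    exact (Ordinal.div_add_mod _ _).symm
  have hble : ∀ β β', β ≤ β' → b β ≤ b β' := fun β β' hβ => Ordinal.div_le_left hβ _
  obtain ⟨M, j, η, hj, hmono, hη, hmem⟩ := h U' hU'
  obtain ⟨E, Seed, hE, hbase, hstep, hval, hlt⟩ := exists_ultrafilter_of_seeds hj hmono hη hmem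
  -- By `hP`, the seeds in `j(P β)` are those of the block of `β`; they are counted by induction on
  -- the position.
  have hseed : ∀ m β, n β = m → Seed (P β) m β := by
    intro m
    induction m with
    | zero =>
      refine fun β hβ => hbase _ _ ((hP β β).2 rfl) fun δ hδ hPδ => ?_
      have h1 := hdm β
      have h2 := hdm δ
      rw [← (hP β δ).1 hPδ] at h2
      rw [hβ, Nat.cast_zero, add_zero] at h1
      refine absurd (show δ.1 < β.1 from hδ) (not_lt.2 ?_)
      rw [h1, h2]
      exact le_self_add
    | succ m ih =>
      intro β hβ
      have h1 := hdm β
      rw [hβ] at h1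
      have h2 : Ordinal.omega0 * (b β).1 + m < β.1 := by
        conv_rhs => rw [h1]
        exact add_lt_add_right (Nat.cast_lt.2 m.lt_succ_self) _
      let δ : Set.Iio α := ⟨Ordinal.omega0 * (b β).1 + m, h2.trans β.2⟩
      have hbδ : b δ = b β := Subtype.ext (by
        change (Ordinal.omega0 * (b β).1 + m) / Ordinal.omega0 = (b β).1
        rw [Ordinal.mul_add_div _ Ordinal.omega0_ne_zero,
          Ordinal.div_eq_zero_of_lt (Ordinal.natCast_lt_omega0 m), add_zero])
      have hnδ : n δ = m := by
        have h3 := hdm δ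
        rw [hbδ] at h3
        exact_mod_cast (add_left_cancel h3).symm
      have hPδ : P δ = P β := by simp only [P, g, hbδ]
      refine hstep _ _ δ β ((hP β β).2 rfl) h2 (hPδ ▸ ih δ hnδ) fun ε hε hPε => ?_
      have h4 := hdm ε
      rw [← (hP β ε).1 hPε] at h4
      have h5 : ε.1 < β.1 := hε
      rw [h4, h1, add_lt_add_iff_left] at h5
      change ε.1 ≤ Ordinal.omega0 * (b β).1 + m
      rw [h4, add_le_add_iff_left]
      exact_mod_cast Nat.lt_succ_iff.1 (Nat.cast_lt.1 h5)
  obtain ⟨W, r, hW, hr⟩ := exists_ultrafilter_seqLT hκ hD hDn hE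
  have hval' : ∀ β X, X ∈ U β →
      ∀ᶠ s in (W : Filter _), ∃ ξ ∈ X, IsNth (n β) (P β) (r s) (g β ξ) := by
    intro β X hX
    refine hr (fun R => ∃ ξ ∈ X, IsNth (n β) (P β) R (g β ξ)) ?_ ?_
    · rintro R ⟨ξ, hξ, hR⟩
      exact ⟨_, fun ζ hζ => ⟨ξ, hξ, hR.inter_Iio hζ⟩⟩
    · refine (hval _ _ β (g β '' X) (hseed _ β rfl) (Ultrafilter.mem_map.2
        (mem_of_superset hX (Set.subset_preimage_image _ _)))).mono ?_
      rintro R ⟨_, ⟨ξ, hξ, rfl⟩, hR⟩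
      exact ⟨ξ, hξ, hR⟩
  have hlt' : ∀ β β', β < β' → ∀ᶠ s in (W : Filter _), ∃ ζ ζ', ζ < ζ' ∧
      IsNth (n β) (P β) (r s) ζ ∧ IsNth (n β') (P β') (r s) ζ' := by
    intro β β' hβ
    refine hr (fun R => ∃ ζ ζ', ζ < ζ' ∧ IsNth (n β) (P β) R ζ ∧ IsNth (n β') (P β') R ζ') ?_
      (hlt _ _ _ _ _ _ (hseed _ β rfl) (hseed _ β' rfl) hβ)
    rintro R ⟨ζ, ζ', hζ, h1, h2⟩
    exact ⟨ζ', fun ξ hξ => ⟨ζ, ζ', hζ, h1.inter_Iio (hζ.trans hξ), h2.inter_Iio hξ⟩⟩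
  obtain ⟨F, hF⟩ : ∃ F : Set.Iio α → SeqLT κ → κ.ord.ToType, ∀ β s ξ,
      IsNth (n β) (P β) (r s) (g β ξ) → F β s = ξ := by
    have : Nonempty κ.ord.ToType := nonempty_of_neBot (D : Filter κ.ord.ToType)
    refine ⟨fun β s => Classical.epsilon fun ξ => IsNth (n β) (P β) (r s) (g β ξ),
      fun β s ξ hξ => hg β ?_⟩
    exact (Classical.epsilon_spec
      (p := fun ξ => IsNth (n β) (P β) (r s) (g β ξ)) ⟨ξ, hξ⟩).unique hξ
  have hFU : ∀ β, W.map (F β) = U β := fun β => by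
    refine Ultrafilter.eq_of_le fun X hX => ?_
    refine Ultrafilter.mem_map.2 (mem_of_superset (hval' β X hX) ?_)
    rintro s ⟨ξ, hξ, hs⟩
    rw [Set.mem_preimage, hF β s ξ hs]
    exact hξ
  have hFle : ∀ β β', β < β' → ∀ᶠ s in (W : Filter _), F β s ≤ F β' s ∧
      (b β = b β' → F β s < F β' s) := by
    intro β β' hβ
    refine (hlt' β β' hβ).mono ?_
    rintro s ⟨ζ, ζ', hζ, h1, h2⟩
    obtain ⟨ξ, rfl⟩ := h1.mem_right
    obtain ⟨ξ', rfl⟩ := h2.mem_right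
    rw [hF β s ξ h1, hF β' s ξ' h2]
    -- Lexicographic codes: `ξ' < ξ` would reverse the order of the coded values.
    refine ⟨le_of_not_gt fun hlt => (he _ _ _ _ hlt).asymm hζ, fun hb => ?_⟩
    simp only [g, hb] at hζ
    exact (he' _).lt_iff_lt.1 hζ
  obtain ⟨N, i, τ, hi, hτ, hU, hi'⟩ := exists_glue_of_ultrafilter hκ hW h0 (fun β => (hU β).2)
    F hFU fun β β' hβ => by
    rcases (hble β β' hβ.le).eq_or_lt with hb | hb
    · exact (hFle β β' hβ).mono fun s hs => hs.2 hb
    · have hb' : (b β).1 < (b β').1 := hb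
      -- In distinct blocks, go through `β + 1`: strict within the block of `β`, then weak up to
      -- `β'`.
      have h1 : β.1 + 1 < β'.1 := by
        have h2 : Ordinal.omega0 * ((b β).1 + 1) ≤ β'.1 := by
          rw [hdm β']
          exact (mul_le_mul_right (Order.add_one_le_of_lt hb') _).trans le_self_add
        refine lt_of_lt_of_le ?_ h2
        rw [hdm β, mul_add_one, add_assoc]
        exact add_lt_add_right (by exact_mod_cast Ordinal.natCast_lt_omega0 (n β + 1)) _
      let δ : Set.Iio α := ⟨β.1 + 1, h1.trans β'.2⟩
      have hβδ : β < δ := show β.1 < β.1 + 1 from lt_add_one _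
      have hbδ : b β = b δ := Subtype.ext (by
        change _ = (β.1 + 1) / Ordinal.omega0
        rw [hdm β, add_assoc, Ordinal.mul_add_div _ Ordinal.omega0_ne_zero,
          Ordinal.div_eq_zero_of_lt (by exact_mod_cast Ordinal.natCast_lt_omega0 (n β + 1)),
          add_zero])
      filter_upwards [hFle β δ hβδ, hFle δ β' h1] with s h2 h3
      exact (h2.2 hbδ).trans_le h3.1
  exact ⟨N, i, τ, hi, hτ, hU, W, hW, hi'⟩

end Main

end Gluing

theorem mainTheorem6 (κ : Cardinal.{u}) (hκ : Gluing.IsMeasurableCardinal κ)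
    (α : Ordinal.{u}) (hα : Ordinal.omega0 ≤ α) (hα' : α < (Order.succ (Order.succ κ)).ord) :
    (Gluing.HasSuperGP κ α → Gluing.HasGPViaUltrafilters κ α) ∧
    (Gluing.HasGPViaUltrafilters κ α → Gluing.HasGP κ α) ∧
    (Gluing.HasGP κ α → Gluing.HasWeakGP κ α) ∧
    (α < (Order.succ κ).ord →
      (Gluing.HasSuperGP κ α ↔ Gluing.HasGPViaUltrafilters κ α) ∧
      (Gluing.HasGPViaUltrafilters κ α ↔ Gluing.HasGP κ α)) := by
  have h0 : 0 < α := Ordinal.omega0_pos.trans_le hα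
  have h12 : Gluing.HasSuperGP κ α → Gluing.HasGPViaUltrafilters κ α :=
    fun h => h.hasGPViaUltrafilters hκ h0 hα'
  have h23 : Gluing.HasGPViaUltrafilters κ α → Gluing.HasGP κ α := fun h U hU => by
    obtain ⟨M, j, η, h1, h2, h3, -⟩ := h U hU
    exact ⟨M, j, η, h1, h2, h3⟩
  refine ⟨h12, h23, fun h U hU => ?_, fun hlt => ?_⟩
  · obtain ⟨M, j, η, h1, -, h3⟩ := h U hU
    exact ⟨M, j, η, h1, h3⟩
  · have h31 : Gluing.HasGP κ α → Gluing.HasSuperGP κ α := fun h => h.hasSuperGP h0 hlt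
    exact ⟨⟨h12, fun h => h31 (h23 h)⟩, h23, fun h => h12 (h31 h)⟩
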